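/- A rational $D(q)$-quadruple is a quadruple $(a,b,c,d)$ of distinct nonzero rationals such that the product of any two of them plus $q$ is the square of a rational. Let $q,m\in\mathbb{Q}$ with $q\neq 0$, $m\neq 0$, $m\neq q^2$, let $\mathcal{D}_m\colon (X^2-q)(Y^2-q)=m$, and fix a rational point $(x_1,y_1)$ on $\mathcal{D}_m$. Let $E_m\colon W^2=T^3+(4q^2-2m)T^2+m^2T$, and let $f$ be the birational map $\mathcal{D}_m\to E_m$ given by $$T=(y_1^2-q)\,\frac{2x_1(y^2-q)x+(x_1^2+q)y^2+x_1^2y_1^2-2x_1^2q-y_1^2q}{(y-y_1)^2},\qquad W=T\cdot\frac{2y_1x(q-y^2)+2x_1y(q-y_1^2)}{y^2-y_1^2};$$ it extends to an isomorphism from the smooth projective model of $\mathcal{D}_m$ to $E_m$. Let $g=(x_1^2-q)\bigl((x\circ f^{-1})^2-q\bigr)$, a rational function on $E_m$. Let $R=(m,2mq)\in E_m(\mathbb{Q})$, let $S=f(-x_1,y_1)\in E_m(\mathbb{Q})$, and let $G$ be the group of permutations of $E_m(\mathbb{Q})$ generated by $P\mapsto S-P$ and $P\mapsto P+R$. (i)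 Let $(Q_1,Q_2,Q_3)\in E_m(\mathbb{Q})^3$ be such that the orbits $G\cdot Q_1,G\cdot Q_2,G\cdot Q_3$ are pairwise disjoint and $(y_1^2-q)\,g(Q_1+Q_2+Q_3)$ is the square of a rational (in particular $Q_1+Q_2+Q_3$ is not a pole of $g$). If $q$ is the square of a rational, assume also that none of $Q_1,Q_2,Q_3$ is a zero or a pole of $g$ (if $q$ is not a square, $g$ has no rational zeros or poles). Then the numbers $$a=\pm\left(\frac1m\cdot\frac{g(Q_1)}{x_1^2-q}\cdot\frac{g(Q_2)}{x_1^2-q}\cdot\frac{g(Q_3)}{x_1^2-q}\right)^{1/2},\quad b=\frac{g(Q_1)}{a(x_1^2-q)},\quad c=\frac{g(Q_2)}{a(x_1^2-q)},\quad d=\frac{g(Q_3)}{a(x_1^2-q)}$$ are rational and, for either choice of sign, $(a,b,c,d)$ is a rational $D(q)$-quadruple with $abcd=m$. (ii) Conversely, let $(a,b,c,d)$ be a rational $D(q)$-quadruple with $abcd=m$, and let $(Q_1,Q_2,Q_3)\in E_m(\mathbb{Q})^3$ be a triple that corresponds to it, that is, $Q_1=f(t_{12},t_{34})$, $Q_2=f(t_{13},t_{24})$,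 $Q_3=f(t_{14},t_{23})$ for some rationals $t_{ij}$ with $ab+q=t_{12}^2$, $ac+q=t_{13}^2$, $ad+q=t_{14}^2$, $bc+q=t_{23}^2$, $bd+q=t_{24}^2$, $cd+q=t_{34}^2$. If $q$ is the square of a rational, assume also that $Q_1+Q_2+Q_3$ is not a pole of $g$. Then $(y_1^2-q)\,g(Q_1+Q_2+Q_3)$ is the square of a rational. -/

import Mathlib

namespace DQuad

open OnePoint WeierstrassCurve

/-- `(a, b, c, d)` is a rational `D(q)`-quadruple: four distinct nonzero rationals such that the
product of any two of them plus `q` is the square of a rational. -/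
def IsDQuadruple (q a b c d : ℚ) : Prop :=
  (a ≠ 0 ∧ b ≠ 0 ∧ c ≠ 0 ∧ d ≠ 0) ∧
  (a ≠ b ∧ a ≠ c ∧ a ≠ d ∧ b ≠ c ∧ b ≠ d ∧ c ≠ d) ∧
  (IsSquare (a * b + q) ∧ IsSquare (a * c + q) ∧ IsSquare (a * d + q) ∧
    IsSquare (b * c + q) ∧ IsSquare (b * d + q) ∧ IsSquare (c * d + q))

/-- The data fixed throughout: a nonzero rational `q`, a rational `m` different from `0` and `q ^ 2`
(so that `D_m : (X ^ 2 - q) * (Y ^ 2 - q) = m` has genus one), and a rational point `(x₁, y₁)` of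
`D_m`. -/
structure Setup where
  q : ℚ
  m : ℚ
  x₁ : ℚ
  y₁ : ℚ
  hq : q ≠ 0
  hm : m ≠ 0
  hmq : m ≠ q ^ 2
  hP₁ : (x₁ ^ 2 - q) * (y₁ ^ 2 - q) = m

theorem f_eq_aux (A B u v k n : ℚ) (hu : u ≠ 0) (hv : v ≠ 0)
    (key : A * B ^ 2 = (A ^ 2 + k * A * u ^ 2 + n ^ 2 * u ^ 4) * v ^ 2) :
    (A / u ^ 2 * (B / (u * v))) ^ 2 = (A / u ^ 2) ^ 3 + k * (A / u ^ 2) ^ 2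
      + n ^ 2 * (A / u ^ 2) := by
  field_simp
  linear_combination A * key

namespace Setup

variable (C : Setup)

/-- The elliptic curve `E_m : W ^ 2 = T ^ 3 + (4 * q ^ 2 - 2 * m) * T ^ 2 + m ^ 2 * T`. -/
def E : WeierstrassCurve.Affine ℚ where
  a₁ := 0
  a₂ := 4 * C.q ^ 2 - 2 * C.m
  a₃ := 0
  a₄ := C.m ^ 2
  a₆ := 0

theorem E_Δ_ne_zero : C.E.Δ ≠ 0 := by
  have h : C.E.Δ = 256 * C.m ^ 4 * C.q ^ 2 * (C.q ^ 2 - C.m) := by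
    simp only [WeierstrassCurve.Δ, WeierstrassCurve.b₂, WeierstrassCurve.b₄, WeierstrassCurve.b₆,
      WeierstrassCurve.b₈, E]
    ring
  rw [h]
  have h1 := C.hq
  have h2 := C.hm
  have h3 : C.q ^ 2 - C.m ≠ 0 := sub_ne_zero.mpr (Ne.symm C.hmq)
  positivity

/-- The rational point of `E_m` with the given coordinates. -/
def mkPoint (t w : ℚ)
    (h : w ^ 2 = t ^ 3 + (4 * C.q ^ 2 - 2 * C.m) * t ^ 2 + C.m ^ 2 * t) : C.E.Point :=
  .some t w <| (Affine.equation_iff_nonsingular_of_Δ_ne_zero C.E_Δ_ne_zero).mp <| by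
    rw [Affine.equation_iff]
    simp only [E]
    linear_combination h

/-- The rational points of the smooth projective model of `D_m` (its closure in `ℙ¹ × ℙ¹`).
These are the affine points `(x, y)`, the points `(∞, r)` with `r ^ 2 = q`, lying over `[1 : 0 : 0]`
in the closure in `ℙ²`, and the points `(r, ∞)` with `r ^ 2 = q`, lying over `[0 : 1 : 0]`. There
are points of the last two kinds only if `q` is the square of a rational. -/
inductive DPoint
  | affine (x y : ℚ) (h : (x ^ 2 - C.q) * (y ^ 2 - C.q) = C.m)
  | xInfty (r : ℚ) (hr : r ^ 2 = C.q)
  | yInfty (r : ℚ) (hr : r ^ 2 = C.q)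

instance : Nonempty C.DPoint := ⟨.affine C.x₁ C.y₁ C.hP₁⟩

/-- The function `x` on the smooth projective model of `D_m`. -/
def DPoint.x {C : Setup} : C.DPoint → OnePoint ℚ
  | .affine x _ _ => (x : OnePoint ℚ)
  | .xInfty _ _ => ∞
  | .yInfty r _ => (r : OnePoint ℚ)

/-- The point `R = (m, 2 m q)`, of order four. -/
def R : C.E.Point :=
  C.mkPoint C.m (2 * C.m * C.q) (by ring)

theorem S_eq (hx : C.x₁ ≠ 0) :
    (C.q * C.y₁ * (C.x₁ ^ 2 + C.y₁ ^ 2) * (C.x₁ ^ 2 - C.q) ^ 2 / C.x₁ ^ 3) ^ 2 =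
      (C.y₁ ^ 2 * (C.x₁ ^ 2 - C.q) ^ 2 / C.x₁ ^ 2) ^ 3
      + (4 * C.q ^ 2 - 2 * C.m) * (C.y₁ ^ 2 * (C.x₁ ^ 2 - C.q) ^ 2 / C.x₁ ^ 2) ^ 2
      + C.m ^ 2 * (C.y₁ ^ 2 * (C.x₁ ^ 2 - C.q) ^ 2 / C.x₁ ^ 2) := by
  rw [← C.hP₁]
  field_simp
  ring

/-- The point `S`, the image of `(-x₁, y₁)`. If `x₁ = 0`, then `(-x₁, y₁)` is the base point, and
`S` is the point at infinity. -/
def S : C.E.Point :=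
  if hx : C.x₁ = 0 then 0
  else C.mkPoint (C.y₁ ^ 2 * (C.x₁ ^ 2 - C.q) ^ 2 / C.x₁ ^ 2)
    (C.q * C.y₁ * (C.x₁ ^ 2 + C.y₁ ^ 2) * (C.x₁ ^ 2 - C.q) ^ 2 / C.x₁ ^ 3) (C.S_eq hx)

/-- The `T`-coordinate of the image of the affine point `(x, y)` of `D_m`. -/
def fT (x y : ℚ) : ℚ :=
  (C.y₁ ^ 2 - C.q) *
    (2 * C.x₁ * (y ^ 2 - C.q) * x + (C.x₁ ^ 2 + C.q) * y ^ 2 + C.x₁ ^ 2 * C.y₁ ^ 2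
      - 2 * C.x₁ ^ 2 * C.q - C.y₁ ^ 2 * C.q) / (y - C.y₁) ^ 2

/-- The `W`-coordinate of the image of the affine point `(x, y)` of `D_m`. -/
def fW (x y : ℚ) : ℚ :=
  C.fT x y * ((2 * C.y₁ * x * (C.q - y ^ 2) + 2 * C.x₁ * y * (C.q - C.y₁ ^ 2))
    / (y ^ 2 - C.y₁ ^ 2))

theorem f_eq (x y : ℚ) (h : (x ^ 2 - C.q) * (y ^ 2 - C.q) = C.m) (hy : y ^ 2 ≠ C.y₁ ^ 2) :
    C.fW x y ^ 2 = C.fT x y ^ 3 + (4 * C.q ^ 2 - 2 * C.m) * C.fT x y ^ 2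
      + C.m ^ 2 * C.fT x y := by
  have hu : y - C.y₁ ≠ 0 := fun h0 => hy (by linear_combination (y + C.y₁) * h0)
  have hv : y + C.y₁ ≠ 0 := fun h0 => hy (by linear_combination (y - C.y₁) * h0)
  have hP := C.hP₁
  unfold fW fT
  generalize C.q = q at *
  generalize C.x₁ = a at *
  generalize C.y₁ = b at *
  generalize C.m = m at *
  subst hP
  have key : ((b ^ 2 - q) * (2 * a * (y ^ 2 - q) * x + (a ^ 2 + q) * y ^ 2 + a ^ 2 * b ^ 2
        - 2 * a ^ 2 * q - b ^ 2 * q))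
        * (2 * b * x * (q - y ^ 2) + 2 * a * y * (q - b ^ 2)) ^ 2
      = (((b ^ 2 - q) * (2 * a * (y ^ 2 - q) * x + (a ^ 2 + q) * y ^ 2 + a ^ 2 * b ^ 2
        - 2 * a ^ 2 * q - b ^ 2 * q)) ^ 2
        + (4 * q ^ 2 - 2 * ((a ^ 2 - q) * (b ^ 2 - q))) * ((b ^ 2 - q) * (2 * a * (y ^ 2 - q) * x
          + (a ^ 2 + q) * y ^ 2 + a ^ 2 * b ^ 2 - 2 * a ^ 2 * q - b ^ 2 * q)) * (y - b) ^ 2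
        + ((a ^ 2 - q) * (b ^ 2 - q)) ^ 2 * (y - b) ^ 4) * (y + b) ^ 2 := by
    linear_combination (8*x*y^4*a*b^4 - 8*x*y^4*a*b^2*q - 16*x*y^2*a*b^4*q + 16*x*y^2*a*b^2*q^2
      + 8*x*a*b^4*q^2 - 8*x*a*b^2*q^3 + 4*y^4*a^2*b^2*q - 4*y^4*a^2*q^2 + 4*y^4*b^4*q
      - 4*y^4*b^2*q^2 + 8*y^3*a^2*b^5 - 16*y^3*a^2*b^3*q + 8*y^3*a^2*b*q^2 - 4*y^2*a^2*b^4*q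
      + 4*y^2*a^2*q^3 - 4*y^2*b^6*q + 4*y^2*b^2*q^3 - 8*y*a^2*b^5*q + 16*y*a^2*b^3*q^2
      - 8*y*a^2*b*q^3 + 4*a^2*b^4*q^2 - 4*a^2*b^2*q^3 + 4*b^6*q^2 - 4*b^4*q^3) * h
  rw [show y ^ 2 - b ^ 2 = (y - b) * (y + b) by ring]
  exact f_eq_aux _ _ _ _ _ _ hu hv key

theorem f_xInfty_eq (r : ℚ) (hr : r ^ 2 = C.q) :
    (2 * C.x₁ * r * ((C.x₁ ^ 2 - C.q) * (C.y₁ + r) ^ 2)) ^ 2 =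
      ((C.x₁ ^ 2 - C.q) * (C.y₁ + r) ^ 2) ^ 3
      + (4 * C.q ^ 2 - 2 * C.m) * ((C.x₁ ^ 2 - C.q) * (C.y₁ + r) ^ 2) ^ 2
      + C.m ^ 2 * ((C.x₁ ^ 2 - C.q) * (C.y₁ + r) ^ 2) := by
  rw [← C.hP₁, ← hr]
  ring

theorem f_yInfty_eq (r : ℚ) (hr : r ^ 2 = C.q) :
    (-2 * C.y₁ * r * ((C.y₁ ^ 2 - C.q) * (C.x₁ + r) ^ 2)) ^ 2 =
      ((C.y₁ ^ 2 - C.q) * (C.x₁ + r) ^ 2) ^ 3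
      + (4 * C.q ^ 2 - 2 * C.m) * ((C.y₁ ^ 2 - C.q) * (C.x₁ + r) ^ 2) ^ 2
      + C.m ^ 2 * ((C.y₁ ^ 2 - C.q) * (C.x₁ + r) ^ 2) := by
  rw [← C.hP₁, ← hr]
  ring

/-- The isomorphism `f` from the smooth projective model of `D_m` to `E_m`, on rational points.
At affine points with `y ^ 2 ≠ y₁ ^ 2` it is given by the rational functions `fT` and `fW`. The
affine points with `y ^ 2 = y₁ ^ 2` are `(± x₁, ± y₁)`, and the extension of `f` to them has the
values `0`, `S`, `S + 2 R` and `2 R` (consistently, if some of these points coincide). At the points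
at infinity the value is the limit of `(fT, fW)` along the curve. -/
def f : C.DPoint → C.E.Point
  | .affine x y h =>
      if hy : y ^ 2 ≠ C.y₁ ^ 2 then C.mkPoint (C.fT x y) (C.fW x y) (C.f_eq x y h hy)
      else if x = C.x₁ ∧ y = C.y₁ then 0
      else if x = -C.x₁ ∧ y = C.y₁ then C.S
      else if x = C.x₁ ∧ y = -C.y₁ then C.S + 2 • C.R
      else 2 • C.R
  | .xInfty r hr => C.mkPoint ((C.x₁ ^ 2 - C.q) * (C.y₁ + r) ^ 2)
      (2 * C.x₁ * r * ((C.x₁ ^ 2 - C.q) * (C.y₁ + r) ^ 2)) (C.f_xInfty_eq r hr)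
  | .yInfty r hr => C.mkPoint ((C.y₁ ^ 2 - C.q) * (C.x₁ + r) ^ 2)
      (-2 * C.y₁ * r * ((C.y₁ ^ 2 - C.q) * (C.x₁ + r) ^ 2)) (C.f_yInfty_eq r hr)

/-- The inverse of `f` (which is a bijection). -/
noncomputable def fInv : C.E.Point → C.DPoint :=
  Function.invFun C.f

/-- The rational function `g = (x₁ ^ 2 - q) * ((x ∘ f⁻¹) ^ 2 - q)` on `E_m`, as a map from the
rational points of `E_m` to `ℙ¹(ℚ)`; the value is `∞` exactly at the poles. -/
noncomputable def g (P : C.E.Point) : OnePoint ℚ :=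
  (C.fInv P).x.map fun x => (C.x₁ ^ 2 - C.q) * (x ^ 2 - C.q)

/-- The group `G` of permutations of `E_m(ℚ)` generated by `P ↦ S - P` and `P ↦ P + R`. -/
def G : Subgroup (Equiv.Perm C.E.Point) :=
  Subgroup.closure {Equiv.subLeft C.S, Equiv.addRight C.R}

/-- The non-degeneracy criteria: the orbits `G · Q₁`, `G · Q₂`, `G · Q₃` are pairwise disjoint. -/
def NonDegenerate (Q₁ Q₂ Q₃ : C.E.Point) : Prop :=
  Disjoint (MulAction.orbit C.G Q₁) (MulAction.orbit C.G Q₂) ∧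
  Disjoint (MulAction.orbit C.G Q₁) (MulAction.orbit C.G Q₃) ∧
  Disjoint (MulAction.orbit C.G Q₂) (MulAction.orbit C.G Q₃)

/-- The triple `(Q₁, Q₂, Q₃)` corresponds to `(a, b, c, d)`, a quadruple with product `m`: it is the
image under `f` of `(t₁₂, t₃₄)`, `(t₁₃, t₂₄)`, `(t₁₄, t₂₃)` for some choice of rational square roots
`tᵢⱼ` of the products of two of `a, b, c, d` plus `q`. -/
def Corresponds (a b c d : ℚ) (Q₁ Q₂ Q₃ : C.E.Point) : Prop :=
  ∃ t₁₂ t₁₃ t₁₄ t₂₃ t₂₄ t₃₄ : ℚ,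
    a * b + C.q = t₁₂ ^ 2 ∧ a * c + C.q = t₁₃ ^ 2 ∧ a * d + C.q = t₁₄ ^ 2 ∧
    b * c + C.q = t₂₃ ^ 2 ∧ b * d + C.q = t₂₄ ^ 2 ∧ c * d + C.q = t₃₄ ^ 2 ∧
    (∃ h, Q₁ = C.f (.affine t₁₂ t₃₄ h)) ∧
    (∃ h, Q₂ = C.f (.affine t₁₃ t₂₄ h)) ∧
    (∃ h, Q₃ = C.f (.affine t₁₄ t₂₃ h))

end Setup

end DQuad

/-!
Triples of points and quadruples. If `abcd = m`, then a pair of square roots of `ab + q` and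
`cd + q` is a point of `D_m`, so a quadruple gives three points `(uᵢ, vᵢ)` of `D_m`, hence three
points `Qᵢ` of `E_m`. Conversely, three points `(uᵢ, vᵢ)` determine `ab`, `ac`, `ad` as
`uᵢ ^ 2 - q`, thus `a ^ 2 = (ab)(ac)(ad) / m`, and everything else once this is the square of a
rational. So the issue is the square class of `m * ∏ (uᵢ ^ 2 - q)`.

On the curve `D_m`, the numerator of `T` factors, and
`T = (y₁ ^ 2 - q) * (y ^ 2 - q) * (x + x₁) ^ 2 / (y - y₁) ^ 2` (`fT_eq`). Since
`(x ^ 2 - q) * (y ^ 2 - q) = m = (x₁ ^ 2 - q) * (y₁ ^ 2 - q)`, the functions `g` and `T` differ by a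
square factor. But `T`, up to squares, is the homomorphism of the descent by the two-torsion point
`(0, 0)` (`isSquare_descent_add`, where its value at `(0, 0)` is the class of `m ^ 2`). Hence the
square class of `g (Q₁ + Q₂ + Q₃)` is that of the product of the `g (Qᵢ)`
(`isSquare_descent_f_add_f_add_f`), and the condition that `(y₁ ^ 2 - q) * g (Q₁ + Q₂ + Q₃)` be a
square says exactly that `a` is rational. When `g` vanishes at `Q₁ + Q₂ + Q₃`, the inverse image of
this point under `f` has `y = ∞`, and `T` has the class of `y₁ ^ 2 - q` there as well.

Two of the numbers `a, b, c, d` are equal just when two of the points `(uᵢ, vᵢ)` agree up to signs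
and the exchange of the coordinates. These symmetries of `D_m` are generated by `(x, y) ↦ (-x, y)`
and `(x, y) ↦ (-y, x)`, which `f` turns into `P ↦ S - P` and `P ↦ P + R` (`f_neg_left`,
`f_rotate`); so the orbits of `G` being disjoint makes the four numbers distinct.

Finally, `g` is evaluated through the inverse of `f`, which makes sense because `f` is onto
(`f_surjective`).
-/

namespace DQuad

open OnePoint WeierstrassCurve

namespace Setup

variable (C : Setup)

/-! ### Addition on `E_m` -/

theorem m_eq : C.m = (C.x₁ ^ 2 - C.q) * (C.y₁ ^ 2 - C.q) := C.hP₁.symm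

theorem x₁_sq_sub_ne_zero : C.x₁ ^ 2 - C.q ≠ 0 := fun h => C.hm (by rw [m_eq, h, zero_mul])

theorem y₁_sq_sub_ne_zero : C.y₁ ^ 2 - C.q ≠ 0 := fun h => C.hm (by rw [m_eq, h, mul_zero])

theorem x₁_sq_add_y₁_sq_ne_zero : C.x₁ ^ 2 + C.y₁ ^ 2 ≠ 0 := by
  intro h
  have hx : C.x₁ ^ 2 = 0 := by nlinarith [sq_nonneg C.x₁, sq_nonneg C.y₁]
  have hy : C.y₁ ^ 2 = 0 := by nlinarith [sq_nonneg C.x₁, sq_nonneg C.y₁]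
  exact C.hmq (by rw [m_eq, hx, hy]; ring)

theorem mkPoint_congr {t w t' w' : ℚ} {h h'} (ht : t = t') (hw : w = w') :
    C.mkPoint t w h = C.mkPoint t' w' h' := by
  subst ht hw; rfl

theorem exists_mkPoint_of_ne_zero {P : C.E.Point} (hP : P ≠ 0) :
    ∃ t w h, P = C.mkPoint t w h := by
  cases P with
  | zero => exact absurd rfl hP
  | some t w h =>
    refine ⟨t, w, ?_, rfl⟩
    have := h.1
    rw [Affine.equation_iff] at this
    simp only [E] at this
    linear_combination this

theorem mkPoint_ne_zero (t w : ℚ) (h) : C.mkPoint t w h ≠ 0 := by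
  intro h; cases h

theorem neg_mkPoint (t w : ℚ) (h) : -C.mkPoint t w h = C.mkPoint t (-w) (by rw [← h]; ring) := by
  refine (Affine.Point.neg_some _).trans ?_
  simp only [mkPoint, Affine.Point.some.injEq, true_and]
  simp [Affine.negY, E]

theorem mkPoint_add_of_ne {t₁ w₁ t₂ w₂ t₃ w₃ l : ℚ} {h₁ h₂ h₃} (ht : t₁ ≠ t₂)
    (hl : l * (t₁ - t₂) = w₁ - w₂) (ht₃ : t₃ = l ^ 2 - (4 * C.q ^ 2 - 2 * C.m) - t₁ - t₂)
    (hw₃ : w₃ = -(l * (t₃ - t₁) + w₁)) :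
    C.mkPoint t₁ w₁ h₁ + C.mkPoint t₂ w₂ h₂ = C.mkPoint t₃ w₃ h₃ := by
  have hs : C.E.slope t₁ t₂ w₁ w₂ = l := by
    rw [Affine.slope_of_X_ne ht, ← hl, mul_div_cancel_right₀ _ (sub_ne_zero.mpr ht)]
  have hx : C.E.addX t₁ t₂ l = t₃ := by simp [Affine.addX, E, ht₃]
  have hy : C.E.addY t₁ t₂ w₁ l = w₃ := by
    simp only [Affine.addY, Affine.negAddY, hx, Affine.negY]
    simp [E, hw₃]
  simp only [mkPoint, Affine.Point.add_of_X_ne ht, hs, hx, hy]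

theorem mkPoint_add_self {t w t₃ w₃ l : ℚ} {h h₃} (hw : w ≠ 0)
    (hl : 2 * w * l = 3 * t ^ 2 + 2 * (4 * C.q ^ 2 - 2 * C.m) * t + C.m ^ 2)
    (ht₃ : t₃ = l ^ 2 - (4 * C.q ^ 2 - 2 * C.m) - t - t) (hw₃ : w₃ = -(l * (t₃ - t) + w)) :
    C.mkPoint t w h + C.mkPoint t w h = C.mkPoint t₃ w₃ h₃ := by
  have hn : w ≠ C.E.negY t w := by
    simp only [Affine.negY, E]
    intro h0; apply hw; linarith
  have hs : C.E.slope t t w w = l := by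
    rw [Affine.slope_of_Y_ne rfl hn, div_eq_iff (sub_ne_zero.mpr hn)]
    simp only [Affine.negY, E]
    linear_combination -hl
  have hx : C.E.addX t t l = t₃ := by simp [Affine.addX, E, ht₃]
  have hy : C.E.addY t t w l = w₃ := by
    simp only [Affine.addY, Affine.negAddY, hx, Affine.negY]
    simp [E, hw₃]
  simp only [mkPoint, Affine.Point.add_self_of_Y_ne hn, hs, hx, hy]

theorem two_nsmul_R : 2 • C.R = C.mkPoint 0 0 (by ring) := by
  have := C.hq
  have := C.hm
  rw [two_nsmul]
  exact C.mkPoint_add_self (l := 2 * C.q) (by positivity) (by ring) (by ring) (by ring)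

theorem four_nsmul_R : 4 • C.R = (0 : C.E.Point) := by
  have h : (-(2 • C.R) : C.E.Point) = 2 • C.R := by
    rw [two_nsmul_R, neg_mkPoint]; exact C.mkPoint_congr rfl neg_zero
  rw [show (4 : ℕ) = 2 + 2 from rfl, add_nsmul]
  nth_rewrite 1 [← h]
  exact neg_add_cancel _

/-- Translation by the two-torsion point `2 R = (0, 0)`, in the coordinates `T` and `U = W / T`. -/
theorem mkPoint_add_two_nsmul_R {T U : ℚ} {h h'} (hT : T ≠ 0) :
    C.mkPoint T (T * U) h + 2 • C.R = C.mkPoint (C.m ^ 2 / T) (C.m ^ 2 / T * -U) h' := by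
  rw [two_nsmul_R]
  have h0 : U ^ 2 * T = T ^ 2 + (4 * C.q ^ 2 - 2 * C.m) * T + C.m ^ 2 :=
    mul_left_cancel₀ hT (by linear_combination h)
  have ht : C.m ^ 2 / T = U ^ 2 - (4 * C.q ^ 2 - 2 * C.m) - T - 0 := by
    rw [div_eq_iff hT]; linear_combination -h0
  exact C.mkPoint_add_of_ne hT (by ring) ht (by ring)

/-- Translation by `R`, in the coordinates `T` and `U = W / T`. -/
theorem mkPoint_add_R {T U W T' U' W' : ℚ} {h h'} (hW : W = T * U) (hW' : W' = T' * U')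
    (hT : T ≠ 0) (hTm : T ≠ C.m)
    (h₁ : T' * (U + 2 * C.q) = C.m * (U - 2 * C.q))
    (h₂ : U' * (T - C.m) = 2 * C.q * (T + C.m)) :
    C.mkPoint T W h + C.R = C.mkPoint T' W' h' := by
  subst hW hW'
  have h0 : U ^ 2 * T = (T - C.m) ^ 2 + 4 * C.q ^ 2 * T :=
    mul_left_cancel₀ hT (by linear_combination h)
  have hd : T - C.m ≠ 0 := sub_ne_zero.mpr hTm
  have hU : U + 2 * C.q ≠ 0 := by
    intro hU
    apply pow_ne_zero 2 hd
    linear_combination -h0 + T * (U - 2 * C.q) * hU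
  have hT' : T' * (T - C.m) ^ 2 = C.m * (U - 2 * C.q) ^ 2 * T := by
    apply mul_right_cancel₀ hU
    linear_combination (T - C.m) ^ 2 * h₁ - C.m * (U - 2 * C.q) * h0
  obtain ⟨l, hl⟩ : ∃ l, l * (T - C.m) = T * U - 2 * C.m * C.q :=
    ⟨(T * U - 2 * C.m * C.q) / (T - C.m), div_mul_cancel₀ _ hd⟩
  have ht : T' = l ^ 2 - (4 * C.q ^ 2 - 2 * C.m) - T - C.m := by
    apply mul_right_cancel₀ (pow_ne_zero 2 hd)
    linear_combination hT' - (l * (T - C.m) + T * U - 2 * C.m * C.q) * hl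
      + (C.m - T) * h0
  refine C.mkPoint_add_of_ne hTm hl ht ?_
  apply mul_right_cancel₀ hd
  apply mul_right_cancel₀ hU
  linear_combination T' * (U + 2 * C.q) * h₂ + (T' - T) * (U + 2 * C.q) * hl
    + (2 * C.q * (T + C.m) + (T * U - 2 * C.m * C.q)) * h₁

/-! ### The map `f` and the reflections of `D_m` -/

/-- The quotient `W / T` at the image of the affine point `(x, y)` of `D_m`. -/
def fU (x y : ℚ) : ℚ :=
  (2 * C.y₁ * x * (C.q - y ^ 2) + 2 * C.x₁ * y * (C.q - C.y₁ ^ 2)) / (y ^ 2 - C.y₁ ^ 2)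

variable {C}

theorem sq_sub_ne_zero {x y : ℚ} (h : (x ^ 2 - C.q) * (y ^ 2 - C.q) = C.m) :
    x ^ 2 - C.q ≠ 0 ∧ y ^ 2 - C.q ≠ 0 := by
  have := C.hm
  rw [← h] at this
  exact mul_ne_zero_iff.mp this

theorem sq_eq_y₁_sq_iff {x y : ℚ} (h : (x ^ 2 - C.q) * (y ^ 2 - C.q) = C.m) :
    y ^ 2 = C.y₁ ^ 2 ↔ x ^ 2 = C.x₁ ^ 2 := by
  have h1 := C.hP₁
  constructor
  · intro e
    rw [e, ← h1] at h
    linear_combination mul_right_cancel₀ C.y₁_sq_sub_ne_zero h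
  · intro e
    rw [e, ← h1] at h
    linear_combination mul_left_cancel₀ C.x₁_sq_sub_ne_zero h

theorem sub_y₁_ne_zero {y : ℚ} (hy : y ^ 2 ≠ C.y₁ ^ 2) : y - C.y₁ ≠ 0 :=
  fun h0 => hy (by linear_combination (y + C.y₁) * h0)

theorem add_y₁_ne_zero {y : ℚ} (hy : y ^ 2 ≠ C.y₁ ^ 2) : y + C.y₁ ≠ 0 :=
  fun h0 => hy (by linear_combination (y - C.y₁) * h0)

/-- On the curve `D_m`, the numerator of `T` factors: `T` is `(y₁ ^ 2 - q) * (y ^ 2 - q)` up to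
squares. -/
theorem fT_eq {x y : ℚ} (h : (x ^ 2 - C.q) * (y ^ 2 - C.q) = C.m) :
    C.fT x y = (C.y₁ ^ 2 - C.q) * (y ^ 2 - C.q) * (x + C.x₁) ^ 2 / (y - C.y₁) ^ 2 := by
  unfold fT
  congr 1
  rw [m_eq] at h
  linear_combination (-(C.y₁ ^ 2 - C.q)) * h

theorem fT_mul_fU_eq {x y : ℚ} (h : (x ^ 2 - C.q) * (y ^ 2 - C.q) = C.m)
    (hy : y ^ 2 ≠ C.y₁ ^ 2) :
    (C.fT x y * C.fU x y) ^ 2 = C.fT x y ^ 3 + (4 * C.q ^ 2 - 2 * C.m) * C.fT x y ^ 2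
      + C.m ^ 2 * C.fT x y :=
  C.f_eq x y h hy

theorem f_of_sq_ne {x y : ℚ} (h : (x ^ 2 - C.q) * (y ^ 2 - C.q) = C.m) (hy : y ^ 2 ≠ C.y₁ ^ 2) :
    C.f (.affine x y h) = C.mkPoint (C.fT x y) (C.fT x y * C.fU x y) (fT_mul_fU_eq h hy) := by
  simp only [f, dif_pos hy]; rfl

theorem fT_ne_zero {x y : ℚ} (h : (x ^ 2 - C.q) * (y ^ 2 - C.q) = C.m) (hy : y ^ 2 ≠ C.y₁ ^ 2) :
    C.fT x y ≠ 0 := by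
  have hx : x + C.x₁ ≠ 0 := fun h0 => hy <| (sq_eq_y₁_sq_iff h).mpr
    (by linear_combination (x - C.x₁) * h0)
  have := (sq_sub_ne_zero h).2
  have := C.y₁_sq_sub_ne_zero
  have := sub_y₁_ne_zero hy
  rw [fT_eq h]
  positivity

variable (C) in
theorem S_eq_two_nsmul_R (hy : C.y₁ = 0) : C.S = 2 • C.R := by
  have hx : C.x₁ ≠ 0 := fun hx => C.x₁_sq_add_y₁_sq_ne_zero (by rw [hx, hy]; ring)
  rw [two_nsmul_R, S, dif_neg hx]
  exact C.mkPoint_congr (by rw [hy]; ring) (by rw [hy]; ring)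

variable (C) in
theorem S_eq_zero (hx : C.x₁ = 0) : C.S = 0 := by
  rw [S, dif_pos hx]

theorem f_base (h) : C.f (.affine C.x₁ C.y₁ h) = 0 := by
  simp [f]

theorem f_neg_x₁ (h) : C.f (.affine (-C.x₁) C.y₁ h) = C.S := by
  by_cases hx : C.x₁ = 0
  · simp [f, hx, S]
  · have : ¬ (-C.x₁ = C.x₁) := fun h => hx (by linarith)
    simp [f, this]

theorem f_neg_y₁ (h) : C.f (.affine C.x₁ (-C.y₁) h) = C.S + 2 • C.R := by
  by_cases hy : C.y₁ = 0
  · have h4 := C.four_nsmul_R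
    rw [S_eq_two_nsmul_R C hy, ← add_nsmul, h4]
    simp [f, hy]
  · have : ¬ (-C.y₁ = C.y₁) := fun h => hy (by linarith)
    simp [f, this]

theorem f_neg_x₁_neg_y₁ (h) : C.f (.affine (-C.x₁) (-C.y₁) h) = 2 • C.R := by
  by_cases hy : C.y₁ = 0
  · have hx : C.x₁ ≠ 0 := fun hx => C.x₁_sq_add_y₁_sq_ne_zero (by rw [hx, hy]; ring)
    have : ¬ (-C.x₁ = C.x₁) := fun h => hx (by linarith)
    rw [← S_eq_two_nsmul_R C hy]
    simp [f, hy, this]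
  · have : ¬ (-C.y₁ = C.y₁) := fun h => hy (by linarith)
    by_cases hx : C.x₁ = 0
    · simp [f, this, hx, S]
    · have h2 : ¬ (-C.x₁ = C.x₁) := fun h => hx (by linarith)
      simp [f, this, h2]

/-- A rational point with `y ^ 2 = y₁ ^ 2` is one of `(± x₁, ± y₁)`. -/
theorem eq_of_sq_eq {x y : ℚ} (h : (x ^ 2 - C.q) * (y ^ 2 - C.q) = C.m) (hy : y ^ 2 = C.y₁ ^ 2) :
    (x = C.x₁ ∨ x = -C.x₁) ∧ (y = C.y₁ ∨ y = -C.y₁) :=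
  ⟨sq_eq_sq_iff_eq_or_eq_neg.mp ((sq_eq_y₁_sq_iff h).mp hy), sq_eq_sq_iff_eq_or_eq_neg.mp hy⟩

/-- The symmetry `(x, y) ↦ (-x, -y)` of `D_m` corresponds to the translation by `2 R`. -/
theorem f_neg_neg {x y : ℚ} (h : (x ^ 2 - C.q) * (y ^ 2 - C.q) = C.m) (h') :
    C.f (.affine (-x) (-y) h') = C.f (.affine x y h) + 2 • C.R := by
  by_cases hy : y ^ 2 = C.y₁ ^ 2
  · have h4 := C.four_nsmul_R
    obtain ⟨rfl | rfl, rfl | rfl⟩ := eq_of_sq_eq h hy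
    · rw [f_neg_x₁_neg_y₁, f_base, zero_add]
    · simp only [neg_neg]
      rw [f_neg_x₁, f_neg_y₁, add_assoc, ← add_nsmul, h4, add_zero]
    · simp only [neg_neg]
      rw [f_neg_x₁, f_neg_y₁]
    · simp only [neg_neg]
      rw [f_neg_x₁_neg_y₁, f_base, ← add_nsmul, h4]
  · have hy' : (-y) ^ 2 ≠ C.y₁ ^ 2 := by rwa [neg_sq]
    have hT : C.fT (-x) (-y) = C.m ^ 2 / C.fT x y := by
      rw [eq_div_iff (fT_ne_zero h hy), fT_eq h, fT_eq h', m_eq]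
      have h1 := sub_y₁_ne_zero hy
      have h2 := sub_y₁_ne_zero hy'
      rw [m_eq] at h
      rw [div_mul_div_comm, div_eq_iff (by positivity)]
      generalize C.q = q at *
      generalize C.x₁ = a at *
      generalize C.y₁ = b at *
      linear_combination (x^2*y^2*b^4 - 2*x^2*y^2*b^2*q + x^2*y^2*q^2 - x^2*b^4*q +
        2*x^2*b^2*q^2 - x^2*q^3 - 2*y^2*a^2*b^4 + 4*y^2*a^2*b^2*q - 2*y^2*a^2*q^2 + y^2*b^4*q -
        2*y^2*b^2*q^2 + y^2*q^3 + a^2*b^6 - a^2*b^4*q - a^2*b^2*q^2 + a^2*q^3 - b^6*q + 2*b^4*q^2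
        - b^2*q^3) * h
    have hU : C.fU (-x) (-y) = -C.fU x y := by
      unfold fU
      ring
    rw [f_of_sq_ne h hy, f_of_sq_ne h' hy', mkPoint_add_two_nsmul_R _ (fT_ne_zero h hy)
      (h' := by rw [← hT, ← hU]; exact fT_mul_fU_eq h' hy')]
    exact C.mkPoint_congr hT (by rw [hT, hU])

/-- The symmetry `(x, y) ↦ (-x, y)` of `D_m` corresponds to `P ↦ S - P`. -/
theorem f_neg_left {x y : ℚ} (h : (x ^ 2 - C.q) * (y ^ 2 - C.q) = C.m) (h') :
    C.f (.affine (-x) y h') = C.S - C.f (.affine x y h) := by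
  by_cases hy : y ^ 2 = C.y₁ ^ 2
  · have h4 := C.four_nsmul_R
    obtain ⟨rfl | rfl, rfl | rfl⟩ := eq_of_sq_eq h hy
    · rw [f_neg_x₁, f_base, sub_zero]
    · rw [f_neg_x₁_neg_y₁, f_neg_y₁, eq_sub_iff_add_eq, add_left_comm, ← add_nsmul, h4, add_zero]
    · simp only [neg_neg]
      rw [f_neg_x₁, f_base, sub_self]
    · simp only [neg_neg]
      rw [f_neg_x₁_neg_y₁, f_neg_y₁, eq_sub_iff_add_eq, add_assoc, ← add_nsmul, h4, add_zero]
  · rw [eq_sub_iff_add_eq, add_comm, f_of_sq_ne h hy, f_of_sq_ne h' hy]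
    have hd := sub_y₁_ne_zero hy
    have hs := add_y₁_ne_zero hy
    have hk := C.y₁_sq_sub_ne_zero
    have hw : y ^ 2 - C.y₁ ^ 2 ≠ 0 := sub_ne_zero.mpr hy
    by_cases ha : C.x₁ = 0
    · rw [C.S_eq_zero ha, ← eq_neg_iff_add_eq_zero, neg_mkPoint]
      apply mkPoint_congr
      · simp [fT, ha]
      · simp [fT, fU, ha]
        ring
    rw [S, dif_neg ha]
    -- `l` is the slope of the line through the two points; written in this form it is also the
    -- slope of the tangent line when they coincide.
    obtain ⟨l, hl⟩ : ∃ l, l = -(C.y₁ * (C.x₁ ^ 2 + C.q) * y + (C.x₁ ^ 2 * C.y₁ ^ 2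
      - 2 * C.q * C.x₁ ^ 2 - C.q * C.y₁ ^ 2)) / (C.x₁ * (y - C.y₁)) := ⟨_, rfl⟩
    have hST : C.y₁ ^ 2 * (C.x₁ ^ 2 - C.q) ^ 2 / C.x₁ ^ 2 =
        l ^ 2 - (4 * C.q ^ 2 - 2 * C.m) - C.fT x y - C.fT (-x) y := by
      rw [fT_eq h, fT_eq h', hl]
      rw [m_eq] at *
      generalize C.q = q at *
      generalize C.x₁ = a at *
      generalize C.y₁ = b at *
      field_simp
      linear_combination (2*a^2*b^2 - 2*a^2*q) * h
    have hSW : C.q * C.y₁ * (C.x₁ ^ 2 + C.y₁ ^ 2) * (C.x₁ ^ 2 - C.q) ^ 2 / C.x₁ ^ 3 =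
        -(l * (C.y₁ ^ 2 * (C.x₁ ^ 2 - C.q) ^ 2 / C.x₁ ^ 2 - C.fT x y) + C.fT x y * C.fU x y) := by
      rw [fT_eq h, fU, hl]
      rw [m_eq] at *
      generalize C.q = q at *
      generalize C.x₁ = a at *
      generalize C.y₁ = b at *
      rw [show y ^ 2 - b ^ 2 = (y - b) * (y + b) by ring]
      field_simp
      linear_combination (-2*x*y^2*a^3*b^3 + 2*x*y^2*a^3*b*q + 2*x*a^3*b^3*q - 2*x*a^3*b*q^2
        - 3*y^2*a^4*b^3 + 3*y^2*a^4*b*q + y^2*a^2*b^3*q - y^2*a^2*b*q^2 + a^4*b^5 + a^4*b^3*q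
        - 2*a^4*b*q^2 - a^2*b^5*q + a^2*b^3*q^2) * h
    by_cases hx : x = 0
    · subst hx
      have hy0 : y ≠ 0 := by
        rintro rfl
        exact C.hmq (by rw [← h]; ring)
      simp only [neg_zero] at hST ⊢
      refine C.mkPoint_add_self (l := l) ?_ ?_ hST hSW
      · apply mul_ne_zero (fT_ne_zero h hy)
        rw [fU, div_ne_zero_iff]
        refine ⟨?_, hw⟩
        rw [show 2 * C.y₁ * 0 * (C.q - y ^ 2) + 2 * C.x₁ * y * (C.q - C.y₁ ^ 2) =
          -(2 * C.x₁ * y * (C.y₁ ^ 2 - C.q)) by ring]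
        exact neg_ne_zero.mpr (mul_ne_zero (by positivity) hk)
      · rw [fT_eq h, fU, hl]
        rw [m_eq] at *
        generalize C.q = q at *
        generalize C.x₁ = a at *
        generalize C.y₁ = b at *
        rw [show y ^ 2 - b ^ 2 = (y - b) * (y + b) by ring]
        field_simp
        linear_combination (2*y^3*a^3*b^2 + 6*y^3*a^3*q + y^3*a*b^2*q - y^3*a*q^2 - 2*y^2*a^3*b^3
          - 6*y^2*a^3*b*q - 3*y^2*a*b^3*q + 3*y^2*a*b*q^2 - 3*y*a^3*b^4 - 5*y*a^3*q^2
          + 3*y*a*b^4*q - 3*y*a*b^2*q^2 + a^3*b^5 + 4*a^3*b^3*q + 3*a^3*b*q^2 - a*b^5*q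
          + a*b^3*q^2) * h
    · have hT : C.fT x y ≠ C.fT (-x) y := by
        have h2 := (sq_sub_ne_zero h).2
        rw [fT_eq h, fT_eq h', Ne, div_left_inj' (pow_ne_zero 2 hd), mul_assoc, mul_assoc,
          mul_right_inj' hk, mul_right_inj' h2]
        intro h0
        exact mul_ne_zero hx ha (by linear_combination h0 / 4)
      refine C.mkPoint_add_of_ne hT ?_ hST hSW
      rw [fT_eq h, fT_eq h', fU, fU, hl]
      rw [m_eq] at *
      generalize C.q = q at *
      generalize C.x₁ = a at *
      generalize C.y₁ = b at *
      rw [show y ^ 2 - b ^ 2 = (y - b) * (y + b) by ring]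
      field_simp
      linear_combination 4*x*a*b*(y^2-q) * h

/-! ### The rotation of `D_m` -/

theorem fT_rotate {x y : ℚ} (h : (x ^ 2 - C.q) * (y ^ 2 - C.q) = C.m)
    (h' : ((-y) ^ 2 - C.q) * (x ^ 2 - C.q) = C.m)
    (hy : y ^ 2 ≠ C.y₁ ^ 2) (hx : x ^ 2 ≠ C.y₁ ^ 2) :
    C.fT (-y) x * (C.fU x y + 2 * C.q) = C.m * (C.fU x y - 2 * C.q) := by
  have h1 := sub_y₁_ne_zero hx
  have h2 : y ^ 2 - C.y₁ ^ 2 ≠ 0 := sub_ne_zero.mpr hy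
  rw [fT_eq h', fU]
  rw [m_eq] at *
  generalize C.q = q at *
  generalize C.x₁ = a at *
  generalize C.y₁ = b at *
  field_simp
  linear_combination (- x*y^2*b^3 + x*y^2*b*q + 2*x*y*a*b^3 - 2*x*y*a*b*q - x*b^3*q + x*b*q^2 +
    y^2*b^2*q - y^2*q^2 - y*a*b^4 + y*a*q^2 + b^4*q - b^2*q^2) * h

theorem fU_rotate {x y : ℚ} (h : (x ^ 2 - C.q) * (y ^ 2 - C.q) = C.m)
    (hy : y ^ 2 ≠ C.y₁ ^ 2) (hx : x ^ 2 ≠ C.y₁ ^ 2) :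
    C.fU (-y) x * (C.fT x y - C.m) = 2 * C.q * (C.fT x y + C.m) := by
  have h1 := sub_y₁_ne_zero hy
  have h2 : x ^ 2 - C.y₁ ^ 2 ≠ 0 := sub_ne_zero.mpr hx
  rw [fT_eq h, fU]
  rw [m_eq] at *
  generalize C.q = q at *
  generalize C.x₁ = a at *
  generalize C.y₁ = b at *
  field_simp
  linear_combination (x^2*y*b^3 - x^2*y*b*q - x^2*b^2*q + x^2*q^2 + 2*x*y*a*b^3 - 2*x*y*a*b*q -
    x*a*b^4 + x*a*q^2 + y*b^3*q - y*b*q^2 - b^4*q + b^2*q^2) * h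

/-- The rotation of the base point goes to `R`. If `x₁ ^ 2 = y₁ ^ 2`, this rotation is `(-x₁, y₁)`
or `(x₁, -y₁)`, and `f` is not given by the formulas there. -/
theorem f_rotate_base (h : ((-C.y₁) ^ 2 - C.q) * (C.x₁ ^ 2 - C.q) = C.m) :
    C.f (.affine (-C.y₁) C.x₁ h) = C.R := by
  by_cases hxy : C.x₁ ^ 2 = C.y₁ ^ 2
  · have hx : C.x₁ ≠ 0 := fun h0 => C.x₁_sq_add_y₁_sq_ne_zero (by rw [← hxy, h0]; ring)
    rcases sq_eq_sq_iff_eq_or_eq_neg.mp hxy with e | e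
    · have hD : DPoint.affine (-C.y₁) C.x₁ h = .affine (-C.x₁) C.y₁ (by rw [← C.hP₁]; ring) := by
        simp [e]
      rw [hD, f_neg_x₁, S, dif_neg hx, R]
      apply mkPoint_congr <;> rw [m_eq, ← e] <;> field_simp
      ring
    · have hy : C.y₁ = -C.x₁ := by rw [e, neg_neg]
      have hD : DPoint.affine (-C.y₁) C.x₁ h = .affine C.x₁ (-C.y₁) (by rw [← C.hP₁]; ring) := by
        simp [e]
      have hS : C.S = -C.R := by
        rw [S, dif_neg hx, R, neg_mkPoint]
        apply mkPoint_congr <;> rw [m_eq, hy] <;> field_simp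
        ring
      rw [hD, f_neg_y₁, hS]
      abel
  · rw [f_of_sq_ne h hxy, R]
    have h1 := sub_y₁_ne_zero hxy
    have h2 : C.x₁ ^ 2 - C.y₁ ^ 2 ≠ 0 := sub_ne_zero.mpr hxy
    have hT : C.fT (-C.y₁) C.x₁ = C.m := by
      rw [fT_eq h, m_eq, div_eq_iff (pow_ne_zero 2 h1)]
      ring
    have hU : C.fU (-C.y₁) C.x₁ = 2 * C.q := by
      rw [fU, div_eq_iff h2]
      ring
    exact C.mkPoint_congr hT (by rw [hT, hU]; ring)

/-- The rotation `(x, y) ↦ (-y, x)` of `D_m` corresponds to the translation by `R`; this is the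
case of the four points `(± x₁, ± y₁)`. -/
theorem f_rotate_of_sq_eq {x y : ℚ} (h : (x ^ 2 - C.q) * (y ^ 2 - C.q) = C.m)
    (h' : ((-y) ^ 2 - C.q) * (x ^ 2 - C.q) = C.m) (hy : y ^ 2 = C.y₁ ^ 2) :
    C.f (.affine (-y) x h') = C.f (.affine x y h) + C.R := by
  have h4 := C.four_nsmul_R
  have hb : ((-C.y₁) ^ 2 - C.q) * (C.x₁ ^ 2 - C.q) = C.m := by rw [← C.hP₁]; ring
  -- `f (-y₁, -x₁) = S - f (y₁, -x₁) = S - (R + 2 R) = S + R`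
  have key (hc) : C.f (.affine (-C.y₁) (-C.x₁) hc) = C.S + C.R := by
    have hd : (C.y₁ ^ 2 - C.q) * ((-C.x₁) ^ 2 - C.q) = C.m := by rw [← C.hP₁]; ring
    have he := f_neg_neg hb (by rwa [neg_neg])
    simp only [neg_neg] at he
    rw [f_neg_left hd, he, f_rotate_base]
    rw [sub_eq_add_neg, add_right_inj, neg_eq_iff_add_eq_zero, ← h4]
    abel
  obtain ⟨rfl | rfl, rfl | rfl⟩ := eq_of_sq_eq h hy
  · rw [f_rotate_base, f_base, zero_add]
  · have hc : ((-C.y₁) ^ 2 - C.q) * ((-C.x₁) ^ 2 - C.q) = C.m := by rw [← C.hP₁]; ring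
    have he := f_neg_neg hc (by rw [← C.hP₁]; ring)
    simp only [neg_neg] at he ⊢
    rw [he, key, f_neg_y₁]
    abel
  · rw [key, f_neg_x₁]
  · have he := f_neg_neg hb (by rw [← C.hP₁]; ring)
    simp only [neg_neg] at he ⊢
    rw [he, f_rotate_base, f_neg_x₁_neg_y₁, add_comm]

/-- The rotation `(x, y) ↦ (-y, x)` of `D_m` corresponds to the translation by `R`. -/
theorem f_rotate {x y : ℚ} (h : (x ^ 2 - C.q) * (y ^ 2 - C.q) = C.m) (h') :
    C.f (.affine (-y) x h') = C.f (.affine x y h) + C.R := by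
  by_cases hy : y ^ 2 = C.y₁ ^ 2
  · exact f_rotate_of_sq_eq h h' hy
  by_cases hx : x ^ 2 = C.y₁ ^ 2
  -- the image is one of the four points; compare `f` at `(-x, -y)`, its rotation, in two ways
  · have he := f_rotate_of_sq_eq h' (by rw [neg_sq, neg_sq]; exact h) hx
    rw [f_neg_neg h, two_nsmul, ← add_assoc] at he
    exact (add_right_cancel he).symm
  rw [f_of_sq_ne h hy, f_of_sq_ne h' hx]
  have hq := C.hq
  have h1 := fT_rotate h h' hy hx
  have hT := fT_ne_zero h hy
  have hT' := fT_ne_zero h' hx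
  refine (C.mkPoint_add_R rfl rfl hT ?_ h1 (fU_rotate h hy hx)).symm
  -- if `T = m`, then `(x, y)` would be sent to `± R`, that is, `U = ± 2 q`
  intro hm
  have h0 : (C.fU x y - 2 * C.q) * (C.fU x y + 2 * C.q) = 0 := by
    apply mul_left_cancel₀ (pow_ne_zero 2 hT)
    linear_combination fT_mul_fU_eq h hy + C.fT x y * (C.fT x y - C.m) * hm
  rcases mul_eq_zero.mp h0 with h0 | h0
  · rw [h0, mul_zero] at h1
    rcases mul_eq_zero.mp h1 with h2 | h2
    · exact hT' h2
    · exact hq (by linarith)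
  · rw [h0, mul_zero] at h1
    rcases mul_eq_zero.mp h1.symm with h2 | h2
    · exact C.hm h2
    · exact hq (by linarith)

theorem f_yInfty_add_R (r : ℚ) (hr : r ^ 2 = C.q) :
    C.f (.yInfty r hr) + C.R = C.f (.xInfty r hr) := by
  have h0 : r ≠ 0 := by rintro rfl; exact C.hq (by rw [← hr]; ring)
  have hA := C.x₁_sq_sub_ne_zero
  have hk := C.y₁_sq_sub_ne_zero
  have hb : C.x₁ + r ≠ 0 := fun h => hA (by linear_combination (C.x₁ - r) * h + hr)
  simp only [f]
  refine C.mkPoint_add_R (U := -2 * C.y₁ * r) (U' := 2 * C.x₁ * r) (by ring) (by ring)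
    (mul_ne_zero hk (pow_ne_zero 2 hb)) (fun h => ?_) ?_ ?_
  · apply mul_ne_zero hk (mul_ne_zero h0 hb)
    rw [m_eq, ← hr] at h
    rw [← hr]
    linear_combination h / 2
  all_goals
    rw [m_eq, ← hr]
    ring

theorem f_xInfty_add_R (r : ℚ) (hr : r ^ 2 = C.q) :
    C.f (.xInfty r hr) + C.R = C.f (.yInfty (-r) (by rwa [neg_sq])) := by
  have h0 : r ≠ 0 := by rintro rfl; exact C.hq (by rw [← hr]; ring)
  have hA := C.x₁_sq_sub_ne_zero
  have hk := C.y₁_sq_sub_ne_zero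
  have hb : C.y₁ + r ≠ 0 := fun h => hk (by linear_combination (C.y₁ - r) * h + hr)
  simp only [f]
  refine C.mkPoint_add_R (U := 2 * C.x₁ * r) (U' := 2 * C.y₁ * r) (by ring) (by ring)
    (mul_ne_zero hA (pow_ne_zero 2 hb)) (fun h => ?_) ?_ ?_
  · apply mul_ne_zero hA (mul_ne_zero h0 hb)
    rw [m_eq, ← hr] at h
    rw [← hr]
    linear_combination h / 2
  all_goals
    rw [m_eq, ← hr]
    ring

/-- The image of `f` is stable under the translations by multiples of `R`. -/
theorem mem_range_f_of_add_R_mem {P : C.E.Point} (hP : P + C.R ∈ Set.range C.f) :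
    P ∈ Set.range C.f := by
  obtain ⟨D, hD⟩ := hP
  cases D with
  | affine x y h =>
    refine ⟨.affine y (-x) (by rw [← h]; ring), ?_⟩
    have := f_rotate (C := C) (x := y) (y := -x) (by rw [← h]; ring) (by rw [← h]; ring)
    simp only [neg_neg] at this
    exact add_right_cancel (this.symm.trans hD)
  | xInfty r hr =>
    exact ⟨.yInfty r hr, add_right_cancel ((f_yInfty_add_R r hr).trans hD)⟩
  | yInfty r hr =>
    refine ⟨.xInfty (-r) (by rwa [neg_sq]), ?_⟩
    have := f_xInfty_add_R (C := C) (-r) (by rwa [neg_sq])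
    simp only [neg_neg] at this
    exact add_right_cancel (this.trans hD)

/-! ### Surjectivity of `f` -/

/-- The inverse of `f`. Write `U = W / T`, `T = (y₁ ^ 2 - q) * t` and `z = x * (y ^ 2 - q)`. The
definitions of `T` and `U` are two equations that are linear in `z`; eliminating `z` from them and
dividing by `y - y₁` leaves an equation that is linear in `y`. Its coefficients both vanish only
at the point excluded by `hbad`, which is `2 R - S`. -/
theorem mkPoint_mem_range_f {T U : ℚ} (hT : T ≠ 0) (h)
    (hbad : ¬ (C.y₁ ^ 2 * T = C.x₁ ^ 2 * (C.y₁ ^ 2 - C.q) ^ 2 ∧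
      C.x₁ * C.y₁ * U = C.q * (C.x₁ ^ 2 + C.y₁ ^ 2))) :
    C.mkPoint T (T * U) h ∈ Set.range C.f := by
  have hA := C.x₁_sq_sub_ne_zero
  have hk := C.y₁_sq_sub_ne_zero
  have hs := C.x₁_sq_add_y₁_sq_ne_zero
  have hq := C.hq
  have hE : U ^ 2 * T = (T - C.m) ^ 2 + 4 * C.q ^ 2 * T :=
    mul_left_cancel₀ hT (by linear_combination h)
  obtain ⟨t, rfl⟩ : ∃ t, T = (C.y₁ ^ 2 - C.q) * t := ⟨T / (C.y₁ ^ 2 - C.q), by field_simp⟩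
  have ht : t ≠ 0 := right_ne_zero_of_mul hT
  have hbad' : ¬ (C.y₁ ^ 2 * t = C.x₁ ^ 2 * (C.y₁ ^ 2 - C.q) ∧
      C.x₁ * C.y₁ * U = C.q * (C.x₁ ^ 2 + C.y₁ ^ 2)) := by
    rintro ⟨h1, h2⟩
    exact hbad ⟨by linear_combination (C.y₁ ^ 2 - C.q) * h1, h2⟩
  have hE' : U ^ 2 * t = (C.y₁ ^ 2 - C.q) * (t - (C.x₁ ^ 2 - C.q)) ^ 2 + 4 * C.q ^ 2 * t := by
    apply mul_left_cancel₀ hk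
    rw [m_eq] at hE
    linear_combination hE
  -- if the coefficient of `y` vanishes, then `y = ∞`
  by_cases hDn : C.x₁ * U + C.y₁ * t - C.y₁ * (C.x₁ ^ 2 + C.q) = 0
  · obtain ⟨r, hr, hU, htr⟩ : ∃ r, r ^ 2 = C.q ∧ U = -2 * C.y₁ * r ∧ t = (C.x₁ + r) ^ 2 := by
      rw [m_eq] at *
      by_cases hb : C.y₁ = 0
      · have ha : C.x₁ ≠ 0 := fun ha => hs (by rw [ha, hb]; ring)
        have hU : U = 0 := by
          rw [hb] at hDn
          exact (mul_eq_zero.mp (by linear_combination hDn)).resolve_left ha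
        obtain ⟨r, hr⟩ : ∃ r, t = C.x₁ ^ 2 + C.q + 2 * C.x₁ * r :=
          ⟨(t - C.x₁ ^ 2 - C.q) / (2 * C.x₁), by field_simp; ring⟩
        have hrq : r ^ 2 = C.q := by
          apply mul_left_cancel₀ (mul_ne_zero hq (pow_ne_zero 2 ha))
          rw [hU, hb, hr] at hE'
          linear_combination hE' / 4
        exact ⟨r, hrq, by rw [hU, hb]; ring, by rw [hr]; linear_combination -hrq⟩
      · obtain ⟨r, hr⟩ : ∃ r, U = -2 * C.y₁ * r := ⟨-U / (2 * C.y₁), by field_simp⟩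
        have htr : t = C.x₁ ^ 2 + C.q + 2 * C.x₁ * r := by
          apply mul_left_cancel₀ hb
          rw [hr] at hDn
          linear_combination hDn
        have h0 : (r ^ 2 - C.q) * (2 * C.x₁ * C.y₁ ^ 2 * r + C.q * (C.x₁ ^ 2 + C.y₁ ^ 2)) = 0 := by
          rw [hr, htr] at hE'
          linear_combination hE' / 4
        rcases mul_eq_zero.mp h0 with h0 | h0
        · have hrq := sub_eq_zero.mp h0
          exact ⟨r, hrq, hr, by rw [htr]; linear_combination -hrq⟩
        · refine absurd ⟨?_, ?_⟩ hbad'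
          · rw [htr]; linear_combination h0
          · rw [hr]; linear_combination -h0
    refine ⟨.yInfty r hr, ?_⟩
    subst hU htr
    exact C.mkPoint_congr (h := C.f_yInfty_eq r hr) rfl (mul_comm _ _)
  obtain ⟨y, hy⟩ : ∃ y, y * (C.x₁ * U + C.y₁ * t - C.y₁ * (C.x₁ ^ 2 + C.q)) =
      -(C.x₁ ^ 2 * C.y₁ ^ 2 - 2 * C.x₁ ^ 2 * C.q - C.y₁ ^ 2 * C.q) - C.x₁ * C.y₁ * U
        + C.y₁ ^ 2 * t :=
    ⟨_, div_mul_cancel₀ _ hDn⟩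
  -- if `y = y₁`, the point is `S`
  by_cases hy1 : y = C.y₁
  · have h1 : C.x₁ * C.y₁ * U = C.q * (C.x₁ ^ 2 + C.y₁ ^ 2) := by
      rw [hy1] at hy; linear_combination hy / 2
    have h2 : C.y₁ ^ 2 * t ≠ C.x₁ ^ 2 * (C.y₁ ^ 2 - C.q) := fun h2 => hbad' ⟨h2, h1⟩
    have hxy : C.x₁ * C.y₁ ≠ 0 := left_ne_zero_of_mul (b := U) (h1 ▸ mul_ne_zero hq hs)
    have hx := left_ne_zero_of_mul hxy
    have hyy := right_ne_zero_of_mul hxy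
    refine ⟨.affine (-C.x₁) C.y₁ (by rw [← C.hP₁]; ring), ?_⟩
    -- given `U`, there are two values of `t`, and `hbad` rules out the other one
    have h3 : C.x₁ ^ 2 * (C.y₁ ^ 2 - C.q) * t = C.y₁ ^ 2 * (C.x₁ ^ 2 - C.q) ^ 2 := by
      apply mul_left_cancel₀ (sub_ne_zero.mpr h2)
      linear_combination -C.x₁ ^ 2 * C.y₁ ^ 2 * hE' +
        (C.x₁ * C.y₁ * U + C.q * (C.x₁ ^ 2 + C.y₁ ^ 2)) * t * h1
    rw [f_neg_x₁, S, dif_neg hx]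
    have h4 : C.y₁ ^ 2 * (C.x₁ ^ 2 - C.q) ^ 2 / C.x₁ ^ 2 = (C.y₁ ^ 2 - C.q) * t := by
      field_simp
      linear_combination -h3
    apply C.mkPoint_congr h4
    rw [← h4, eq_div_of_mul_eq hxy ((mul_comm _ _).trans h1)]
    field_simp
  -- if `y = -y₁`, the point is `S + 2 R`, since `hbad` rules out its negative
  by_cases hy2 : y = -C.y₁
  · have h1 : C.y₁ ^ 2 * t = C.x₁ ^ 2 * (C.y₁ ^ 2 - C.q) := by
      rw [hy2] at hy; linear_combination -hy / 2
    have hyy : C.y₁ ≠ 0 := by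
      intro h0
      rw [h0] at h1
      have h5 : C.x₁ ^ 2 = 0 := (mul_eq_zero.mp (by linear_combination h1)).resolve_right hq
      exact hs (by rw [h5, h0]; ring)
    have hx : C.x₁ ≠ 0 := by
      intro h0
      rw [h0] at h1
      exact mul_ne_zero (pow_ne_zero 2 hyy) ht (by linear_combination h1)
    have h2 : C.x₁ * C.y₁ * U = -(C.q * (C.x₁ ^ 2 + C.y₁ ^ 2)) := by
      refine (sq_eq_sq_iff_eq_or_eq_neg.mp ?_).resolve_left fun h2 => hbad' ⟨h1, h2⟩
      apply mul_left_cancel₀ hk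
      linear_combination C.y₁ ^ 4 * hE' + (-U ^ 2 * C.y₁ ^ 2 + 4 * C.q ^ 2 * C.y₁ ^ 2 +
        (C.y₁ ^ 2 - C.q) * (C.y₁ ^ 2 * t + C.x₁ ^ 2 * (C.y₁ ^ 2 - C.q)
          - 2 * C.y₁ ^ 2 * (C.x₁ ^ 2 - C.q))) * h1
    refine ⟨.affine C.x₁ (-C.y₁) (by rw [← C.hP₁]; ring), ?_⟩
    have ht' : C.m ^ 2 / (C.y₁ ^ 2 * (C.x₁ ^ 2 - C.q) ^ 2 / C.x₁ ^ 2) = (C.y₁ ^ 2 - C.q) * t := by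
      rw [m_eq]
      field_simp
      linear_combination -h1
    have hU : U = -(C.q * (C.x₁ ^ 2 + C.y₁ ^ 2) / (C.x₁ * C.y₁)) := by
      field_simp
      linear_combination h2
    have hS : C.S = C.mkPoint (C.y₁ ^ 2 * (C.x₁ ^ 2 - C.q) ^ 2 / C.x₁ ^ 2)
        (C.y₁ ^ 2 * (C.x₁ ^ 2 - C.q) ^ 2 / C.x₁ ^ 2 *
          (C.q * (C.x₁ ^ 2 + C.y₁ ^ 2) / (C.x₁ * C.y₁))) (by
        rw [← C.S_eq hx]; field_simp) := by
      rw [S, dif_neg hx]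
      apply C.mkPoint_congr rfl
      field_simp
    rw [f_neg_y₁, hS, mkPoint_add_two_nsmul_R _ (by positivity) (h' := by rw [ht', ← hU]; exact h)]
    exact C.mkPoint_congr ht' (by rw [ht', hU])
  have hysq : y ^ 2 ≠ C.y₁ ^ 2 := by
    rw [Ne, sq_eq_sq_iff_eq_or_eq_neg]; tauto
  have hd := sub_y₁_ne_zero hysq
  have hs' := add_y₁_ne_zero hysq
  -- the two equations for `z` are proportional, with coefficients `x₁` and `y₁`, not both zero
  obtain ⟨z, hz1, hz2⟩ : ∃ z, 2 * C.x₁ * z = t * (y - C.y₁) ^ 2 - ((C.x₁ ^ 2 + C.q) * y ^ 2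
      + C.x₁ ^ 2 * C.y₁ ^ 2 - 2 * C.x₁ ^ 2 * C.q - C.y₁ ^ 2 * C.q) ∧
      2 * C.y₁ * z = -U * (y ^ 2 - C.y₁ ^ 2) - 2 * C.x₁ * y * (C.y₁ ^ 2 - C.q) := by
    refine ⟨(C.x₁ * (t * (y - C.y₁) ^ 2 - ((C.x₁ ^ 2 + C.q) * y ^ 2
      + C.x₁ ^ 2 * C.y₁ ^ 2 - 2 * C.x₁ ^ 2 * C.q - C.y₁ ^ 2 * C.q)) + C.y₁ *
      (-U * (y ^ 2 - C.y₁ ^ 2) - 2 * C.x₁ * y * (C.y₁ ^ 2 - C.q))) /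
      (2 * (C.x₁ ^ 2 + C.y₁ ^ 2)), ?_, ?_⟩ <;> field_simp
    · linear_combination -C.y₁ * (y - C.y₁) * hy
    · linear_combination C.x₁ * (y - C.y₁) * hy
  -- `hF` is the equation of `D_m`; the equation of `E_m` in terms of `y` and `z` is its multiple,
  -- with the cofactor `hc` that does not vanish
  have hF : z ^ 2 = (y ^ 2 - C.q) * (C.q * y ^ 2 + C.m - C.q ^ 2) := by
    have hc : C.y₁ ^ 2 * t - C.x₁ ^ 2 * (C.y₁ ^ 2 - C.q) ≠ 0 := by
      intro h0
      apply hDn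
      apply mul_left_cancel₀ hs'
      linear_combination hy + 2 * h0
    have h1 : (2 * C.y₁ * z + 2 * C.x₁ * y * (C.y₁ ^ 2 - C.q)) ^ 2 * (t * (y - C.y₁) ^ 2)
        - (C.y₁ ^ 2 - C.q) * (y + C.y₁) ^ 2 *
          (t * (y - C.y₁) ^ 2 - (C.x₁ ^ 2 - C.q) * (y - C.y₁) ^ 2) ^ 2
        - 4 * C.q ^ 2 * (t * (y - C.y₁) ^ 2) * (y ^ 2 - C.y₁ ^ 2) ^ 2 = 0 := by
      rw [hz2]
      linear_combination (y - C.y₁) ^ 2 * (y ^ 2 - C.y₁ ^ 2) ^ 2 * hE'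
    have h2 : t * (y - C.y₁) ^ 2 = 2 * C.x₁ * z + ((C.x₁ ^ 2 + C.q) * y ^ 2
      + C.x₁ ^ 2 * C.y₁ ^ 2 - 2 * C.x₁ ^ 2 * C.q - C.y₁ ^ 2 * C.q) := by
      linear_combination -hz1
    rw [h2] at h1
    rw [m_eq]
    apply mul_left_cancel₀ hc
    apply mul_left_cancel₀ (pow_ne_zero 2 hd)
    linear_combination h1 / 4 + C.y₁ ^ 2 * (z ^ 2 - (y ^ 2 - C.q) * (C.q * y ^ 2
      + (C.x₁ ^ 2 - C.q) * (C.y₁ ^ 2 - C.q) - C.q ^ 2)) * h2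
  -- if `y ^ 2 = q`, then `x = ∞`; otherwise `x = z / (y ^ 2 - q)`
  by_cases hyq : y ^ 2 = C.q
  · have hz : z = 0 := by
      rw [hyq] at hF; simpa using hF
    refine ⟨.xInfty y hyq, ?_⟩
    have h1 : (C.x₁ ^ 2 - C.q) * (C.y₁ + y) ^ 2 = (C.y₁ ^ 2 - C.q) * t := by
      apply mul_right_cancel₀ (pow_ne_zero 2 hd)
      rw [hz, ← hyq] at hz1
      rw [← hyq]
      linear_combination (C.y₁ ^ 2 - y ^ 2) * hz1
    have h2 : 2 * C.x₁ * y = U := by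
      apply mul_left_cancel₀ hk
      rw [hz, ← hyq] at hz2
      rw [← hyq]
      linear_combination hz2
    exact C.mkPoint_congr (h := C.f_xInfty_eq y hyq) h1 (by rw [h1, h2, mul_comm])
  · have hY : y ^ 2 - C.q ≠ 0 := sub_ne_zero.mpr hyq
    have hD : ((z / (y ^ 2 - C.q)) ^ 2 - C.q) * (y ^ 2 - C.q) = C.m := by
      field_simp
      linear_combination hF
    refine ⟨.affine (z / (y ^ 2 - C.q)) y hD, ?_⟩
    rw [f_of_sq_ne hD hysq]
    have h1 : C.fT (z / (y ^ 2 - C.q)) y = (C.y₁ ^ 2 - C.q) * t := by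
      rw [fT, div_eq_iff (pow_ne_zero 2 hd)]
      field_simp
      linear_combination hz1
    have h2 : C.fU (z / (y ^ 2 - C.q)) y = U := by
      rw [fU, div_eq_iff (sub_ne_zero.mpr hysq)]
      have h3 : z / (y ^ 2 - C.q) * (C.q - y ^ 2) = -z := by
        field_simp
        ring
      linear_combination 2 * C.y₁ * h3 - hz2
    exact C.mkPoint_congr h1 (by rw [h1, h2])

theorem R_ne_zero : C.R ≠ 0 := C.mkPoint_ne_zero _ _ _

/-- A rational point is in the image of `f`, unless it is the point where the formula for
`f⁻¹` breaks down. -/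
theorem mem_range_f_or (P : C.E.Point) : P ∈ Set.range C.f ∨ ∃ T U h, P = C.mkPoint T (T * U) h ∧
    C.y₁ ^ 2 * T = C.x₁ ^ 2 * (C.y₁ ^ 2 - C.q) ^ 2 ∧
    C.x₁ * C.y₁ * U = C.q * (C.x₁ ^ 2 + C.y₁ ^ 2) := by
  by_cases hP : P = 0
  · exact .inl ⟨_, (f_base C.hP₁).trans hP.symm⟩
  obtain ⟨T, W, h, rfl⟩ := C.exists_mkPoint_of_ne_zero hP
  by_cases hT : T = 0
  · subst hT
    have hW : W = 0 := by
      apply pow_eq_zero_iff (two_ne_zero) |>.mp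
      rw [h]; ring
    subst hW
    refine .inl ⟨_, (f_neg_x₁_neg_y₁ (by rw [← C.hP₁]; ring)).trans ?_⟩
    rw [two_nsmul_R]
  · obtain ⟨U, rfl⟩ : ∃ U, W = T * U := ⟨W / T, by field_simp⟩
    by_cases hb : C.y₁ ^ 2 * T = C.x₁ ^ 2 * (C.y₁ ^ 2 - C.q) ^ 2 ∧
        C.x₁ * C.y₁ * U = C.q * (C.x₁ ^ 2 + C.y₁ ^ 2)
    · exact .inr ⟨T, U, h, rfl, hb⟩
    · exact .inl (mkPoint_mem_range_f hT h hb)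

/-- The map `f` is onto: the translate by `R` of the only point where the formula for `f⁻¹` breaks
down is another point, and the image of `f` is stable under translation by `R`. -/
theorem f_surjective : Function.Surjective C.f := by
  intro P
  rcases mem_range_f_or P with hP | ⟨T, U, h, hP, hT, hU⟩
  · exact hP
  rcases mem_range_f_or (P + C.R) with hR | ⟨T', U', h', hP', hT', hU'⟩
  · exact mem_range_f_of_add_R_mem hR
  have hxy : C.x₁ * C.y₁ ≠ 0 :=
    left_ne_zero_of_mul (b := U) (hU ▸ mul_ne_zero C.hq C.x₁_sq_add_y₁_sq_ne_zero)
  have hy : C.y₁ ≠ 0 := right_ne_zero_of_mul hxy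
  have hTT : T' = T := mul_left_cancel₀ (pow_ne_zero 2 hy) (hT'.trans hT.symm)
  have hUU : U' = U := mul_left_cancel₀ hxy (hU'.trans hU.symm)
  subst hTT hUU
  exact absurd (add_eq_left.mp (hP'.trans hP.symm)) R_ne_zero

/-! ### Descent by the two-torsion point -/

/-- The descent map of the two-torsion point `(0, 0)`: the abscissa, with values to be considered up
to squares. It is `1` at infinity and also at `(0, 0)`, where its class is that of `m ^ 2`. -/
def descent : C.E.Point → ℚ
  | .zero => 1
  | .some t _ _ => if t = 0 then 1 else t

theorem descent_zero : descent (0 : C.E.Point) = 1 := rfl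

theorem descent_mkPoint {t w : ℚ} {h} (ht : t ≠ 0) : descent (C.mkPoint t w h) = t := if_neg ht

theorem descent_two_nsmul_R : descent (2 • C.R) = 1 := by
  rw [two_nsmul_R]
  exact (if_pos rfl : (if (0 : ℚ) = 0 then (1 : ℚ) else 0) = 1)

theorem descent_ne_zero (P : C.E.Point) : descent P ≠ 0 := by
  cases P with
  | zero => exact one_ne_zero
  | some t w h =>
    by_cases ht : t = 0
    · simp [descent, ht]
    · simp [descent, ht]

/-- Vieta's formulas for the abscissae of three collinear points of `E_m`. -/
theorem abscissae_of_collinear {t₁ w₁ t₂ w₂ : ℚ} (h₁ : C.E.Equation t₁ w₁) (h₂ : C.E.Equation t₂ w₂)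
    (h : ¬(t₁ = t₂ ∧ w₁ = C.E.negY t₂ w₂)) :
    ∃ l n, t₁ * t₂ * C.E.addX t₁ t₂ (C.E.slope t₁ t₂ w₁ w₂) = n ^ 2 ∧
      t₁ * t₂ + t₁ * C.E.addX t₁ t₂ (C.E.slope t₁ t₂ w₁ w₂)
        + t₂ * C.E.addX t₁ t₂ (C.E.slope t₁ t₂ w₁ w₂) = C.m ^ 2 - 2 * l * n := by
  have hp := Affine.addPolynomial_slope h₁ h₂ h
  have hd := Affine.derivative_addPolynomial_slope h₁ h₂ h
  rw [Affine.addPolynomial_eq] at hp hd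
  generalize C.E.slope t₁ t₂ w₁ w₂ = l at *
  generalize C.E.addX t₁ t₂ l = t₃ at *
  refine ⟨l, w₁ - l * t₁, ?_, ?_⟩
  · have := congrArg (Polynomial.eval 0) hp
    simp [Cubic.toPoly, E] at this
    linear_combination -this
  · have := congrArg (Polynomial.eval 0) hd
    simp [Cubic.toPoly, E, Polynomial.derivative_pow] at this
    linear_combination this

/-- The descent map is multiplicative up to squares: the product of the abscissae of three points
on a line `W = l T + n` is `n ^ 2`. -/
theorem isSquare_descent_add (P Q : C.E.Point) :
    IsSquare (descent (P + Q) * (descent P * descent Q)) := by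
  cases P with
  | zero => exact ⟨descent Q, by change descent (0 + Q) * (1 * _) = _; rw [zero_add, one_mul]⟩
  | some t₁ w₁ h₁ =>
    cases Q with
    | zero => exact ⟨_, by change descent (_ + 0) * (_ * 1) = _; rw [add_zero, mul_one]⟩
    | some t₂ w₂ h₂ =>
      by_cases h : t₁ = t₂ ∧ w₁ = C.E.negY t₂ w₂
      · rw [Affine.Point.add_of_Y_eq h.1 h.2, descent_zero]
        obtain ⟨rfl, -⟩ := h
        exact ⟨_, one_mul _⟩
      · rw [Affine.Point.add_some h]
        obtain ⟨l, n, hn, hl⟩ := abscissae_of_collinear h₁.1 h₂.1 h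
        generalize_proofs h₃
        generalize C.E.addX t₁ t₂ (C.E.slope t₁ t₂ w₁ w₂) = t₃ at *
        have hm := C.hm
        simp only [descent]
        by_cases h0 : t₁ * t₂ * t₃ = 0
        · -- if one abscissa vanishes, then the product of the other two is `m ^ 2`
          have hn0 : n = 0 := by rw [h0] at hn; exact pow_eq_zero_iff two_ne_zero |>.mp hn.symm
          rw [hn0, mul_zero, sub_zero] at hl
          refine ⟨C.m, ?_⟩
          rcases mul_eq_zero.mp h0 with h0 | h0
          · rcases mul_eq_zero.mp h0 with h0 | h0
            · subst h0
              have h1 : t₂ * t₃ ≠ 0 := by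
                rw [show t₂ * t₃ = C.m ^ 2 by linear_combination hl]; positivity
              rw [if_pos rfl, if_neg (left_ne_zero_of_mul h1), if_neg (right_ne_zero_of_mul h1)]
              linear_combination hl
            · subst h0
              have h1 : t₁ * t₃ ≠ 0 := by
                rw [show t₁ * t₃ = C.m ^ 2 by linear_combination hl]; positivity
              rw [if_pos rfl, if_neg (left_ne_zero_of_mul h1), if_neg (right_ne_zero_of_mul h1)]
              linear_combination hl
          · subst h0
            have h1 : t₁ * t₂ ≠ 0 := by
              rw [show t₁ * t₂ = C.m ^ 2 by linear_combination hl]; positivity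
            rw [if_pos rfl, if_neg (left_ne_zero_of_mul h1), if_neg (right_ne_zero_of_mul h1)]
            linear_combination hl
        · have h1 := left_ne_zero_of_mul h0
          rw [if_neg (right_ne_zero_of_mul h0), if_neg (left_ne_zero_of_mul h1),
            if_neg (right_ne_zero_of_mul h1)]
          exact ⟨n, by linear_combination hn⟩

theorem isSquare_mul_trans {a b c : ℚ} (hb : b ≠ 0) (hab : IsSquare (a * b))
    (hbc : IsSquare (b * c)) : IsSquare (a * c) := by
  have : a * c = a * b * (b * c) / (b * b) := by field_simp
  rw [this]
  exact (hab.mul hbc).div ⟨b, rfl⟩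

theorem isSquare_descent_add_add (P Q T : C.E.Point) :
    IsSquare (descent (P + Q + T) * (descent P * descent Q * descent T)) := by
  have h1 := isSquare_descent_add (P + Q) T
  have h2 := (isSquare_descent_add P Q).mul (IsSquare.mul_self (descent T))
  refine isSquare_mul_trans (b := descent (P + Q) * descent T)
    (mul_ne_zero (descent_ne_zero _) (descent_ne_zero _)) h1 ?_
  exact Eq.mp (congrArg IsSquare (by ring)) h2

/-! ### Square classes of the values of `g` -/

theorem isSquare_descent_S : IsSquare (descent C.S) := by
  by_cases hx : C.x₁ = 0
  · rw [S_eq_zero C hx, descent_zero]; exact IsSquare.one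
  by_cases hy : C.y₁ = 0
  · rw [S_eq_two_nsmul_R C hy, descent_two_nsmul_R]; exact IsSquare.one
  have hA := C.x₁_sq_sub_ne_zero
  rw [S, dif_neg hx, descent_mkPoint (by positivity)]
  exact ⟨C.y₁ * (C.x₁ ^ 2 - C.q) / C.x₁, by ring⟩

/-- The square class of the descent map on the image of an affine point `(x, y)`: it is that of
`g = (x₁ ^ 2 - q) * (x ^ 2 - q)`. -/
theorem isSquare_descent_f_affine {x y : ℚ} (h : (x ^ 2 - C.q) * (y ^ 2 - C.q) = C.m) :
    IsSquare (descent (C.f (.affine x y h)) * ((C.x₁ ^ 2 - C.q) * (x ^ 2 - C.q))) := by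
  by_cases hy : y ^ 2 = C.y₁ ^ 2
  · rw [(sq_eq_y₁_sq_iff h).mp hy]
    refine IsSquare.mul ?_ (IsSquare.mul_self _)
    obtain ⟨rfl | rfl, rfl | rfl⟩ := eq_of_sq_eq h hy
    · rw [f_base, descent_zero]; exact IsSquare.one
    · have h1 := isSquare_descent_add C.S (2 • C.R)
      rw [descent_two_nsmul_R, mul_one] at h1
      have h2 := isSquare_mul_trans (c := 1) (descent_ne_zero _) h1
        (by rw [mul_one]; exact isSquare_descent_S)
      rw [f_neg_y₁]
      rwa [mul_one] at h2
    · rw [f_neg_x₁]; exact isSquare_descent_S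
    · rw [f_neg_x₁_neg_y₁, descent_two_nsmul_R]; exact IsSquare.one
  · rw [f_of_sq_ne h hy, descent_mkPoint (fT_ne_zero h hy), fT_eq h]
    refine ⟨C.m * (x + C.x₁) / (y - C.y₁), ?_⟩
    have hm := C.hP₁
    have h1 : C.m * C.m =
        (x ^ 2 - C.q) * (y ^ 2 - C.q) * ((C.x₁ ^ 2 - C.q) * (C.y₁ ^ 2 - C.q)) := by
      rw [h, hm]
    rw [div_mul_div_comm, show C.m * (x + C.x₁) * (C.m * (x + C.x₁)) =
      C.m * C.m * (x + C.x₁) ^ 2 by ring, h1]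
    ring

theorem isSquare_descent_f_add_f_add_f {u₁ v₁ u₂ v₂ u₃ v₃ : ℚ}
    (e₁ : (u₁ ^ 2 - C.q) * (v₁ ^ 2 - C.q) = C.m) (e₂ : (u₂ ^ 2 - C.q) * (v₂ ^ 2 - C.q) = C.m)
    (e₃ : (u₃ ^ 2 - C.q) * (v₃ ^ 2 - C.q) = C.m) :
    IsSquare (descent (C.f (.affine u₁ v₁ e₁) + C.f (.affine u₂ v₂ e₂) + C.f (.affine u₃ v₃ e₃)) *
      ((C.x₁ ^ 2 - C.q) ^ 3 * ((u₁ ^ 2 - C.q) * (u₂ ^ 2 - C.q) * (u₃ ^ 2 - C.q)))) := by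
  have h := ((isSquare_descent_f_affine e₁).mul
    (isSquare_descent_f_affine e₂)).mul (isSquare_descent_f_affine e₃)
  refine isSquare_mul_trans (mul_ne_zero (mul_ne_zero (descent_ne_zero _)
    (descent_ne_zero _)) (descent_ne_zero _)) (isSquare_descent_add_add _ _ _) ?_
  exact Eq.mp (congrArg IsSquare (by ring)) h

theorem isSquare_descent_f_yInfty (r : ℚ) (hr : r ^ 2 = C.q) :
    IsSquare (descent (C.f (.yInfty r hr)) * (C.y₁ ^ 2 - C.q)) := by
  have hA := C.x₁_sq_sub_ne_zero
  have hk := C.y₁_sq_sub_ne_zero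
  have hb : C.x₁ + r ≠ 0 := fun h => hA (by linear_combination (C.x₁ - r) * h + hr)
  simp only [f]
  rw [descent_mkPoint (mul_ne_zero hk (pow_ne_zero 2 hb))]
  exact ⟨(C.y₁ ^ 2 - C.q) * (C.x₁ + r), by ring⟩

/-- The values of `g`, with the point of `D_m` at which `x` is evaluated: an affine point, or a
point at infinity, which is a zero or a pole of `g`. -/
theorem g_cases (P : C.E.Point) :
    (∃ x y h, P = C.f (.affine x y h) ∧
      C.g P = (((C.x₁ ^ 2 - C.q) * (x ^ 2 - C.q) : ℚ) : OnePoint ℚ)) ∨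
    (∃ r hr, P = C.f (.yInfty r hr) ∧ C.g P = ((0 : ℚ) : OnePoint ℚ)) ∨
    (∃ r, r ^ 2 = C.q ∧ C.g P = ∞) := by
  have hP : C.f (C.fInv P) = P := Function.invFun_eq (f_surjective P)
  unfold g
  generalize C.fInv P = D at hP
  subst hP
  cases D with
  | affine x y h => exact .inl ⟨x, y, h, rfl, rfl⟩
  | xInfty r hr => exact .inr (.inr ⟨r, hr, rfl⟩)
  | yInfty r hr =>
    refine .inr (.inl ⟨r, hr, rfl, ?_⟩)
    simp [DPoint.x, hr]

/-- If `(y₁ ^ 2 - q) * g P` is a square, then `P` has the square class of `y₁ ^ 2 - q`. This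
includes the zeros of `g`, where the hypothesis holds trivially, because those have this square
class anyway. -/
theorem isSquare_descent_mul {P : C.E.Point} {s : ℚ} (hs : C.g P = (s : OnePoint ℚ))
    (h : IsSquare ((C.y₁ ^ 2 - C.q) * s)) : IsSquare (descent P * (C.y₁ ^ 2 - C.q)) := by
  rcases g_cases P with ⟨x, y, hD, hP, hg⟩ | ⟨r, hr, hP, -⟩ | ⟨r, -, hg⟩
  · rw [hs, OnePoint.coe_eq_coe] at hg
    subst hg
    rw [mul_comm] at h
    have h1 := isSquare_descent_f_affine hD
    rw [← hP] at h1
    exact isSquare_mul_trans (mul_ne_zero C.x₁_sq_sub_ne_zero (sq_sub_ne_zero hD).1) h1 h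
  · rw [hP]
    exact isSquare_descent_f_yInfty r hr
  · rw [hs] at hg
    exact absurd hg (OnePoint.coe_ne_infty _)

theorem exists_g_eq {P : C.E.Point} (hP : IsSquare C.q → C.g P ≠ ∞)
    (h : IsSquare (descent P * (C.y₁ ^ 2 - C.q))) :
    ∃ s : ℚ, C.g P = (s : OnePoint ℚ) ∧ IsSquare ((C.y₁ ^ 2 - C.q) * s) := by
  rcases g_cases P with ⟨x, y, hD, hf, hg⟩ | ⟨r, hr, -, hg⟩ | ⟨r, hr, hg⟩
  · refine ⟨_, hg, ?_⟩
    have h1 := isSquare_descent_f_affine hD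
    rw [← hf] at h1
    rw [mul_comm] at h
    exact isSquare_mul_trans (descent_ne_zero P) h h1
  · exact ⟨0, hg, by rw [mul_zero]; exact IsSquare.zero⟩
  · exact absurd hg (hP ⟨r, by rw [← hr, sq]⟩)

/-! ### Orbits of `G` -/

theorem orbit_add_R (P : C.E.Point) :
    MulAction.orbit C.G (P + C.R) = MulAction.orbit C.G P :=
  MulAction.orbit_eq_iff.mpr
    ⟨⟨Equiv.addRight C.R, Subgroup.subset_closure (.inr rfl)⟩, rfl⟩

theorem orbit_S_sub (P : C.E.Point) :
    MulAction.orbit C.G (C.S - P) = MulAction.orbit C.G P :=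
  MulAction.orbit_eq_iff.mpr
    ⟨⟨Equiv.subLeft C.S, Subgroup.subset_closure (.inl rfl)⟩, rfl⟩

/-- The points `(± x, ± y)` of `D_m` are sent to the same orbit of `G`. -/
theorem orbit_eq_of_sq_eq {x y x' y' : ℚ} (h : (x ^ 2 - C.q) * (y ^ 2 - C.q) = C.m)
    (h' : (x' ^ 2 - C.q) * (y' ^ 2 - C.q) = C.m) (hx : x ^ 2 = x' ^ 2) :
    MulAction.orbit C.G (C.f (.affine x y h)) = MulAction.orbit C.G (C.f (.affine x' y' h')) := by
  have hy : y ^ 2 = y' ^ 2 := by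
    have h1 := h.trans h'.symm
    rw [hx] at h1
    linear_combination mul_left_cancel₀ (sq_sub_ne_zero h').1 h1
  rcases sq_eq_sq_iff_eq_or_eq_neg.mp hx with rfl | rfl <;>
    rcases sq_eq_sq_iff_eq_or_eq_neg.mp hy with rfl | rfl
  · rfl
  · have h1 : ((-x) ^ 2 - C.q) * (y' ^ 2 - C.q) = C.m := by rw [← h]; ring
    have h2 := f_neg_neg h1 (by rw [← h]; ring)
    simp only [neg_neg] at h2
    rw [h2, two_nsmul, ← add_assoc, orbit_add_R, orbit_add_R, f_neg_left h', orbit_S_sub]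
  · rw [f_neg_left h', orbit_S_sub]
  · rw [f_neg_neg h', two_nsmul, ← add_assoc, orbit_add_R, orbit_add_R]

/-- The points `(± x, ± y)` and `(± y, ± x)` of `D_m` are sent to the same orbit of `G`. -/
theorem orbit_eq_of_sq_eq_swap {x y x' y' : ℚ} (h : (x ^ 2 - C.q) * (y ^ 2 - C.q) = C.m)
    (h' : (x' ^ 2 - C.q) * (y' ^ 2 - C.q) = C.m) (hx : x' ^ 2 = y ^ 2) :
    MulAction.orbit C.G (C.f (.affine x y h)) = MulAction.orbit C.G (C.f (.affine x' y' h')) := by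
  have h1 : ((-y) ^ 2 - C.q) * (x ^ 2 - C.q) = C.m := by rw [← h]; ring
  rw [← orbit_add_R, ← f_rotate h h1]
  exact orbit_eq_of_sq_eq h1 h' (by rw [neg_sq, hx])

theorem not_disjoint_of_orbit_eq {P Q : C.E.Point}
    (h : MulAction.orbit C.G P = MulAction.orbit C.G Q)
    (hd : Disjoint (MulAction.orbit C.G P) (MulAction.orbit C.G Q)) : False := by
  rw [h, disjoint_self] at hd
  exact (MulAction.nonempty_orbit Q).ne_empty hd

end Setup

end DQuad

theorem theorem1 (C : DQuad.Setup) :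
    (∀ Q₁ Q₂ Q₃ : C.E.Point, C.NonDegenerate Q₁ Q₂ Q₃ →
      (IsSquare C.q → ∀ Q ∈ ({Q₁, Q₂, Q₃} : Set C.E.Point),
        C.g Q ≠ OnePoint.infty ∧ C.g Q ≠ ((0 : ℚ) : OnePoint ℚ)) →
      (∃ s : ℚ, C.g (Q₁ + Q₂ + Q₃) = (s : OnePoint ℚ) ∧ IsSquare ((C.y₁ ^ 2 - C.q) * s)) →
      ∃ g₁ g₂ g₃ : ℚ,
        C.g Q₁ = (g₁ : OnePoint ℚ) ∧ C.g Q₂ = (g₂ : OnePoint ℚ) ∧ C.g Q₃ = (g₃ : OnePoint ℚ) ∧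
        IsSquare (1 / C.m * (g₁ / (C.x₁ ^ 2 - C.q)) * (g₂ / (C.x₁ ^ 2 - C.q)) *
          (g₃ / (C.x₁ ^ 2 - C.q))) ∧
        ∀ a b c d : ℚ,
          a ^ 2 = 1 / C.m * (g₁ / (C.x₁ ^ 2 - C.q)) * (g₂ / (C.x₁ ^ 2 - C.q)) *
            (g₃ / (C.x₁ ^ 2 - C.q)) →
          b = g₁ / (a * (C.x₁ ^ 2 - C.q)) →
          c = g₂ / (a * (C.x₁ ^ 2 - C.q)) →
          d = g₃ / (a * (C.x₁ ^ 2 - C.q)) →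
          DQuad.IsDQuadruple C.q a b c d ∧ a * b * c * d = C.m) ∧
    (∀ a b c d : ℚ, DQuad.IsDQuadruple C.q a b c d → a * b * c * d = C.m →
      ∀ Q₁ Q₂ Q₃ : C.E.Point, C.Corresponds a b c d Q₁ Q₂ Q₃ →
      (IsSquare C.q → C.g (Q₁ + Q₂ + Q₃) ≠ OnePoint.infty) →
      ∃ s : ℚ, C.g (Q₁ + Q₂ + Q₃) = (s : OnePoint ℚ) ∧ IsSquare ((C.y₁ ^ 2 - C.q) * s)) := by
  have hA := C.x₁_sq_sub_ne_zero
  have hk := C.y₁_sq_sub_ne_zero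
  have hm := C.hm
  constructor
  · intro Q₁ Q₂ Q₃ ⟨h12, h13, h23⟩ hq ⟨s, hs, hsq⟩
    have haff (Q : C.E.Point) (hQ : Q ∈ ({Q₁, Q₂, Q₃} : Set C.E.Point)) :
        ∃ x y h, Q = C.f (.affine x y h) ∧
          C.g Q = (((C.x₁ ^ 2 - C.q) * (x ^ 2 - C.q) : ℚ) : OnePoint ℚ) := by
      rcases DQuad.Setup.g_cases Q with h | ⟨r, hr, -, hg⟩ | ⟨r, hr, hg⟩
      · exact h
      · exact absurd hg (hq ⟨r, by rw [← hr, sq]⟩ Q hQ).2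
      · exact absurd hg (hq ⟨r, by rw [← hr, sq]⟩ Q hQ).1
    obtain ⟨u₁, v₁, e₁, rfl, hg₁⟩ := haff Q₁ (by simp)
    obtain ⟨u₂, v₂, e₂, rfl, hg₂⟩ := haff Q₂ (by simp)
    obtain ⟨u₃, v₃, e₃, rfl, hg₃⟩ := haff Q₃ (by simp)
    obtain ⟨hX₁, hY₁⟩ := DQuad.Setup.sq_sub_ne_zero e₁
    obtain ⟨hX₂, hY₂⟩ := DQuad.Setup.sq_sub_ne_zero e₂
    obtain ⟨hX₃, hY₃⟩ := DQuad.Setup.sq_sub_ne_zero e₃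
    refine ⟨_, _, _, hg₁, hg₂, hg₃, ?_, ?_⟩
    · have h1 := DQuad.Setup.isSquare_descent_mul hs hsq
      rw [mul_comm] at h1
      have h2 := DQuad.Setup.isSquare_mul_trans (DQuad.Setup.descent_ne_zero _) h1
        (DQuad.Setup.isSquare_descent_f_add_f_add_f e₁ e₂ e₃)
      have h3 := h2.div (IsSquare.mul_self ((C.y₁ ^ 2 - C.q) * (C.x₁ ^ 2 - C.q) ^ 2))
      refine Eq.mp (congrArg IsSquare ?_) h3
      rw [C.m_eq]
      field_simp
    · intro a b c d ha hb hc hd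
      rw [mul_div_cancel_left₀ _ hA, mul_div_cancel_left₀ _ hA, mul_div_cancel_left₀ _ hA] at ha
      have ha0 : a ≠ 0 := by
        rintro rfl
        have : 1 / C.m * (u₁ ^ 2 - C.q) * (u₂ ^ 2 - C.q) * (u₃ ^ 2 - C.q) ≠ 0 := by positivity
        exact this (by rw [← ha]; ring)
      have hab : a * b = u₁ ^ 2 - C.q := by rw [hb]; field_simp
      have hac : a * c = u₂ ^ 2 - C.q := by rw [hc]; field_simp
      have had : a * d = u₃ ^ 2 - C.q := by rw [hd]; field_simp
      clear hb hc hd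
      have habcd : a * b * c * d = C.m := by
        apply mul_left_cancel₀ (pow_ne_zero 2 ha0)
        rw [show a ^ 2 * (a * b * c * d) = a * b * (a * c) * (a * d) by ring, ha, hab, hac, had]
        field_simp
      have hcd : c * d = v₁ ^ 2 - C.q :=
        mul_left_cancel₀ hX₁ (by rw [e₁, ← habcd, ← hab]; ring)
      have hbd : b * d = v₂ ^ 2 - C.q :=
        mul_left_cancel₀ hX₂ (by rw [e₂, ← habcd, ← hac]; ring)
      have hbc : b * c = v₃ ^ 2 - C.q :=
        mul_left_cancel₀ hX₃ (by rw [e₃, ← habcd, ← had]; ring)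
      refine ⟨⟨⟨ha0, right_ne_zero_of_mul (hab ▸ hX₁), right_ne_zero_of_mul (hac ▸ hX₂),
        right_ne_zero_of_mul (had ▸ hX₃)⟩, ⟨?_, ?_, ?_, ?_, ?_, ?_⟩,
        ⟨u₁, by rw [hab]; ring⟩, ⟨u₂, by rw [hac]; ring⟩, ⟨u₃, by rw [had]; ring⟩,
        ⟨v₃, by rw [hbc]; ring⟩, ⟨v₂, by rw [hbd]; ring⟩, ⟨v₁, by rw [hcd]; ring⟩⟩, habcd⟩
      -- if two of the four numbers coincide, then so do, up to signs and order, two of the points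
      -- `(uᵢ, vᵢ)`, against the disjointness of the orbits
      · rintro rfl
        exact DQuad.Setup.not_disjoint_of_orbit_eq
          (DQuad.Setup.orbit_eq_of_sq_eq_swap e₂ e₃ (by linear_combination hbd - had)) h23
      · rintro rfl
        exact DQuad.Setup.not_disjoint_of_orbit_eq
          (DQuad.Setup.orbit_eq_of_sq_eq_swap e₁ e₃ (by linear_combination hcd - had)) h13
      · rintro rfl
        exact DQuad.Setup.not_disjoint_of_orbit_eq
          (DQuad.Setup.orbit_eq_of_sq_eq_swap e₁ e₂ (by linear_combination hcd - hac)) h12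
      · rintro rfl
        exact DQuad.Setup.not_disjoint_of_orbit_eq
          (DQuad.Setup.orbit_eq_of_sq_eq e₁ e₂ (by linear_combination hac - hab)) h12
      · rintro rfl
        exact DQuad.Setup.not_disjoint_of_orbit_eq
          (DQuad.Setup.orbit_eq_of_sq_eq e₁ e₃ (by linear_combination had - hab)) h13
      · rintro rfl
        exact DQuad.Setup.not_disjoint_of_orbit_eq
          (DQuad.Setup.orbit_eq_of_sq_eq e₂ e₃ (by linear_combination had - hac)) h23
  · rintro a b c d - habcd Q₁ Q₂ Q₃ ⟨t₁₂, t₁₃, t₁₄, t₂₃, t₂₄, t₃₄, h₁₂, h₁₃, h₁₄, -, -, -,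
      ⟨e₁, rfl⟩, ⟨e₂, rfl⟩, ⟨e₃, rfl⟩⟩ hq
    refine DQuad.Setup.exists_g_eq hq ?_
    have h := DQuad.Setup.isSquare_descent_f_add_f_add_f e₁ e₂ e₃
    have hX₁ := (DQuad.Setup.sq_sub_ne_zero e₁).1
    have hX₂ := (DQuad.Setup.sq_sub_ne_zero e₂).1
    have hX₃ := (DQuad.Setup.sq_sub_ne_zero e₃).1
    refine DQuad.Setup.isSquare_mul_trans (by positivity) h ⟨(C.x₁ ^ 2 - C.q) * a * C.m, ?_⟩
    rw [← h₁₂, ← h₁₃, ← h₁₄]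
    have := C.m_eq
    linear_combination (-(C.x₁ ^ 2 - C.q) ^ 2 * a ^ 2 * C.m) * this +
      (C.x₁ ^ 2 - C.q) ^ 3 * a ^ 2 * (C.y₁ ^ 2 - C.q) * habcd
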